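/- Let $Q$ be a finite-dimensional, connected, paracompact (Hausdorff) smooth manifold without boundary, let $T^1_kQ=TQ\oplus\overset{k}{\cdots}\oplus TQ$ with elements $v=(v_1,\dots,v_k)$, and let $(T^1_k)^*Q=T^*Q\oplus\overset{k}{\cdots}\oplus T^*Q$ with elements $(\alpha^1,\dots,\alpha^k)$ and projection $\tau_Q^*$ onto $Q$. A $k$-vector field on a manifold $M$ is a smooth section of $T^1_kM\to M$, and $T^1_kf(v_1,\dots,v_k)=(f_*v_1,\dots,f_*v_k)$ for a smooth map $f$. On $(T^1_k)^*Q$ let $(\omega_0)_A=-d(\theta_0)_A$, where $(\theta_0)_A(\alpha)(X)=\alpha^A((\tau_Q^*)_*X)$, $1\le A\le k$. For a smooth $L\colon T^1_kQ\to\mathbb R$ let $FL\colon T^1_kQ\to(T^1_k)^*Q$, $[FL(v)]^A(w)=\frac{d}{ds}\big|_{0}L(v_1,\dots,v_A+sw,\dots,v_k)$, be its Legendre map and $E_L=C(L)-L$ its energy, $C$ being the Liouville vector field (generator of $(s,v)\mapsto e^sv$). A field operator for $L$ is a smooth map $\mathcal K=(\mathcal K_1,\dots,\mathcal K_k)\colon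 T^1_kQ\to T^1_k((T^1_k)^*Q)$ such that (1) $\mathcal K(v)$ lies over $FL(v)$, that is, $\mathcal K$ is a $k$-vector field along $FL$; (2) $\sum_A(FL)^*[\,i_{\mathcal K_A}((\omega_0)_A\circ FL)]=dE_L$; (3) $T^1_k(\tau_Q^*)\circ\mathcal K=\mathrm{Id}_{T^1_kQ}$ (second-order condition). $L$ is almost-regular if $\mathcal P=FL(T^1_kQ)$ is a closed (embedded) submanifold of $(T^1_k)^*Q$, with inclusion $j_0$, the map $FL_0\colon T^1_kQ\to\mathcal P$ with $j_0\circ FL_0=FL$ is a submersion, and the fibres $FL^{-1}(FL(v))$ are connected submanifolds. $L$ is hyper-regular if $FL$ is a diffeomorphism onto $(T^1_k)^*Q$. **Theorem.** (a) Let $L$ be almost-regular. There is a smooth function $H_0\colon\mathcal P\to\mathbb R$ (necessarily unique) with $H_0\circ FL_0=E_L$. Put $\omega^0_A=j_0^*(\omega_0)_A$. Let $X_0=((X_0)_1,\dots,(X_0)_k)$ be a $k$-vector field on $\mathcal P$ and let $S$ be a submanifold (or just any subset) of $T^1_kQ$. (i) If $\mathcal K$ is a field operator for $L$ and $T^1_kj_0\circ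 X_0\circ FL_0=\mathcal K$ at the points of $S$, then $$\sum_{A=1}^k i_{(X_0)_A}\omega^0_A=dH_0\qquad(*)$$ at every point of $P=FL_0(S)$. (ii) Conversely, if $X_0$ satisfies $(*)$ at every point of $P=FL_0(S)$ (in particular, if it satisfies it on $\mathcal P$), then $T^1_kj_0\circ X_0\circ FL_0$ is a smooth $k$-vector field along $FL$, and every map $\mathcal K$ that agrees with it on $S$ satisfies conditions (1) and (2) at the points of $S$. (b) In (ii), condition (3) need not hold: for every $Q$ as above with $\dim Q\ge1$ and every $k\ge1$ there are an almost-regular $L$ on $T^1_kQ$ and a $k$-vector field $X_0$ on $\mathcal P$ satisfying $(*)$ on all of $\mathcal P$ such that $T^1_kj_0\circ X_0\circ FL_0$ does not satisfy (3) on $T^1_kQ$. (c) Let $L$ be hyper-regular, let $H=E_L\circ FL^{-1}$, and let $X$ be a $k$-vector field on $(T^1_k)^*Q$. If $X\circ FL=\mathcal K$ for some field operator $\mathcal K$ for $L$, then $\sum_A i_{X_A}(\omega_0)_A=dH$ on $(T^1_k)^*Q$. Conversely, if $\sum_A i_{X_A}(\omega_0)_A=dH$ on $(T^1_k)^*Q$,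 then $\mathcal K=X\circ FL$ satisfies (1), (2) and (3), and hence is a field operator for $L$. -/

import Mathlib

open Set Bundle Manifold
open scoped ContDiff Topology

universe uQ

noncomputable section

namespace KSymplectic

section Velocities

variable (k : ℕ)
  {E : Type*} [NormedAddCommGroup E] [NormedSpace ℝ E]
  {H : Type*} [TopologicalSpace H] (I : ModelWithCorners ℝ E H)
  (M : Type*) [TopologicalSpace M] [ChartedSpace H M]

/-- The bundle `T¹ₖM` of `k¹`-velocities.  The `1`-jet at `0` of a map `σ : ℝᵏ → M` is the linear
map `dσ(0) : ℝᵏ → T_q M`, and the Whitney sum `TM ⊕ ⋯ ⊕ TM` is recovered by evaluating at the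
canonical basis: `(v₁, …, vₖ) = (v(e₁), …, v(eₖ))`.  So `T¹ₖM` is the smooth vector bundle
`Hom(ℝᵏ, TM)`. -/
abbrev T1k : Type _ :=
  TotalSpace ((Fin k → ℝ) →L[ℝ] E)
    (fun x : M => Bundle.Trivial M (Fin k → ℝ) x →L[ℝ] TangentSpace I x)

/-- The bundle `(T¹ₖ)*M` of `k¹`-covelocities.  The `1`-jet at `q` of a map `σ : M → ℝᵏ` with
`σ(q) = 0` is the linear map `dσ(q) : T_q M → ℝᵏ`, and the Whitney sum `T*M ⊕ ⋯ ⊕ T*M` is recovered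
by taking components: `αᴬ(w) = α(w) A`. -/
abbrev T1kStar : Type _ :=
  TotalSpace (E →L[ℝ] (Fin k → ℝ))
    (fun x : M => TangentSpace I x →L[ℝ] Bundle.Trivial M (Fin k → ℝ) x)

/-- The model with corners of `T¹ₖM`. -/
abbrev velModel := I.prod 𝓘(ℝ, (Fin k → ℝ) →L[ℝ] E)

/-- The model with corners of `(T¹ₖ)*M`. -/
abbrev covelModel := I.prod 𝓘(ℝ, E →L[ℝ] (Fin k → ℝ))

end Velocities

section Instances

/-! Shortcuts to the smooth bundle structures that Mathlib puts on bundles of linear maps. -/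

variable (k : ℕ)
  {E : Type*} [NormedAddCommGroup E] [NormedSpace ℝ E]
  {H : Type*} [TopologicalSpace H] (I : ModelWithCorners ℝ E H)
  (M : Type*) [TopologicalSpace M] [ChartedSpace H M]

instance T1k.instTopologicalSpace [IsManifold I 1 M] : TopologicalSpace (T1k k I M) :=
  Bundle.ContinuousLinearMap.topologicalSpaceTotalSpace (RingHom.id ℝ) (Fin k → ℝ)
    (Bundle.Trivial M (Fin k → ℝ)) E (fun x : M => TangentSpace I x)

instance T1k.instFiberBundle [IsManifold I 1 M] :
    FiberBundle ((Fin k → ℝ) →L[ℝ] E)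
      (fun x : M => Bundle.Trivial M (Fin k → ℝ) x →L[ℝ] TangentSpace I x) :=
  Bundle.ContinuousLinearMap.fiberBundle (RingHom.id ℝ) (Fin k → ℝ)
    (Bundle.Trivial M (Fin k → ℝ)) E (fun x : M => TangentSpace I x)

instance T1k.instVectorBundle [IsManifold I 1 M] :
    VectorBundle ℝ ((Fin k → ℝ) →L[ℝ] E)
      (fun x : M => Bundle.Trivial M (Fin k → ℝ) x →L[ℝ] TangentSpace I x) :=
  Bundle.ContinuousLinearMap.vectorBundle (RingHom.id ℝ) (Fin k → ℝ)
    (Bundle.Trivial M (Fin k → ℝ)) E (fun x : M => TangentSpace I x)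

instance T1k.instContMDiffVectorBundle [IsManifold I ∞ M] :
    ContMDiffVectorBundle ∞ ((Fin k → ℝ) →L[ℝ] E)
      (fun x : M => Bundle.Trivial M (Fin k → ℝ) x →L[ℝ] TangentSpace I x) I :=
  ContMDiffVectorBundle.continuousLinearMap (n := ∞) (F₁ := (Fin k → ℝ)) (F₂ := E) (IB := I)
    (E₁ := Bundle.Trivial M (Fin k → ℝ)) (E₂ := fun x : M => TangentSpace I x)

instance T1k.instChartedSpace [IsManifold I 1 M] :
    ChartedSpace (ModelProd H ((Fin k → ℝ) →L[ℝ] E)) (T1k k I M) :=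
  FiberBundle.chartedSpace

instance T1k.instIsManifold [IsManifold I ∞ M] :
    IsManifold (velModel k I) ∞ (T1k k I M) := inferInstance

instance T1kStar.instIsManifold [IsManifold I ∞ M] :
    IsManifold (covelModel k I) ∞ (T1kStar k I M) := inferInstance

instance T1kStar.instIsManifoldOne [IsManifold I ∞ M] :
    IsManifold (covelModel k I) 1 (T1kStar k I M) := inferInstance

end Instances

section Functor

variable {k : ℕ}
  {E : Type*} [NormedAddCommGroup E] [NormedSpace ℝ E]
  {H : Type*} [TopologicalSpace H] (I : ModelWithCorners ℝ E H)
  {M : Type*} [TopologicalSpace M] [ChartedSpace H M]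
  {E' : Type*} [NormedAddCommGroup E'] [NormedSpace ℝ E']
  {H' : Type*} [TopologicalSpace H'] (J : ModelWithCorners ℝ E' H')
  {N : Type*} [TopologicalSpace N] [ChartedSpace H' N]

/-- The vector `v_A = v(e_A)`, the `A`-th component of `v = (v₁, …, vₖ)`. -/
def component {x : M} (v : Bundle.Trivial M (Fin k → ℝ) x →L[ℝ] TangentSpace I x) (A : Fin k) :
    TangentSpace I x :=
  v (Pi.single A (1 : ℝ) : Fin k → ℝ)

/-- The induced map `T¹ₖ(f) : T¹ₖM → T¹ₖN`, `(v₁, …, vₖ) ↦ (f_* v₁, …, f_* vₖ)`. -/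
def T1kMap (f : M → N) (v : T1k k I M) : T1k k J N :=
  ⟨f v.proj, (mfderiv I J f v.proj).comp v.snd⟩

/-- `k`-vector fields on `M`: smooth sections of `T¹ₖM → M`. -/
abbrev KVectorField (k : ℕ) {E : Type*} [NormedAddCommGroup E] [NormedSpace ℝ E]
    {H : Type*} [TopologicalSpace H] (I : ModelWithCorners ℝ E H)
    (M : Type*) [TopologicalSpace M] [ChartedSpace H M] [IsManifold I ∞ M] : Type _ :=
  ContMDiffSection I ((Fin k → ℝ) →L[ℝ] E) ∞
    (fun x : M => Bundle.Trivial M (Fin k → ℝ) x →L[ℝ] TangentSpace I x)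

/-- A `k`-vector field as a map `M → T¹ₖM`. -/
def KVectorField.toMap [IsManifold I ∞ M] (X : KVectorField k I M) (x : M) : T1k k I M :=
  ⟨x, X x⟩

end Functor

section Forms

variable {E : Type*} [NormedAddCommGroup E] [NormedSpace ℝ E]
  {H : Type*} [TopologicalSpace H] (I : ModelWithCorners ℝ E H)
  {M : Type*} [TopologicalSpace M] [ChartedSpace H M]
  {E' : Type*} [NormedAddCommGroup E'] [NormedSpace ℝ E']
  {H' : Type*} [TopologicalSpace H'] (J : ModelWithCorners ℝ E' H')
  {N : Type*} [TopologicalSpace N] [ChartedSpace H' N]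

/-- The coordinate expression of a `1`-form `θ` in the chart at `x₀`. -/
def oneFormInChart (θ : ∀ x : M, TangentSpace I x →L[ℝ] ℝ) (x₀ : M) (y : E) : E →L[ℝ] ℝ :=
  (θ ((extChartAt I x₀).symm y)).comp
    (mfderivWithin 𝓘(ℝ, E) I (extChartAt I x₀).symm (range I) y)

/-- The value at `x` of the exterior derivative of a `1`-form, computed in the chart `φ` at `x`:
`dθ(u, w) = D_u(θ(w)) - D_w(θ(u))`. -/
def extDerivOneForm (θ : ∀ x : M, TangentSpace I x →L[ℝ] ℝ) (x : M)
    (u w : TangentSpace I x) : ℝ :=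
  let D : E →L[ℝ] E →L[ℝ] ℝ :=
    fderivWithin ℝ (oneFormInChart I θ x) (range I) (extChartAt I x x)
  let u' : E := mfderiv I 𝓘(ℝ, E) (extChartAt I x) x u
  let w' : E := mfderiv I 𝓘(ℝ, E) (extChartAt I x) x w
  D u' w' - D w' u'

/-- The pull-back `f^* Ω` of a `2`-form. -/
def pullbackTwoForm (f : M → N) (Ω : ∀ y : N, TangentSpace J y → TangentSpace J y → ℝ)
    (x : M) (u w : TangentSpace I x) : ℝ :=
  Ω (f x) (mfderiv I J f x u) (mfderiv I J f x w)

/-- The equation `∑_A i_{X_A} Ω_A = dF` at the point `x`. -/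
def SolvesHamiltonAt {k : ℕ} [IsManifold I ∞ M]
    (Ω : Fin k → ∀ x : M, TangentSpace I x → TangentSpace I x → ℝ) (F : M → ℝ)
    (X : KVectorField k I M) (x : M) : Prop :=
  ∀ w : TangentSpace I x, ∑ A, Ω A x (component I (X x) A) w = mfderiv I 𝓘(ℝ, ℝ) F x w

end Forms

section Lagrangian

variable {k : ℕ}
  {E : Type*} [NormedAddCommGroup E] [NormedSpace ℝ E]
  {H : Type*} [TopologicalSpace H] (I : ModelWithCorners ℝ E H)
  {Q : Type*} [TopologicalSpace Q] [ChartedSpace H Q] [IsManifold I ∞ Q]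

/-- The bundle projection `τ_Q^* : (T¹ₖ)*Q → Q`. -/
def tauStar : T1kStar k I Q → Q := TotalSpace.proj

/-- The Liouville form `(θ₀)_A` on `(T¹ₖ)*Q`: `(θ₀)_A(α)(X) = αᴬ((τ_Q^*)_* X)`. -/
def liouvilleForm (A : Fin k) (α : T1kStar k I Q) :
    TangentSpace (covelModel k I) α →L[ℝ] ℝ :=
  ((ContinuousLinearMap.proj (R := ℝ) (φ := fun _ : Fin k => ℝ) A).comp α.snd).comp
    (mfderiv (covelModel k I) I (tauStar (k := k) I (Q := Q)) α)

/-- The canonical polysymplectic forms `(ω₀)_A = -d(θ₀)_A` on `(T¹ₖ)*Q`. -/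
def canonicalForm (A : Fin k) (α : T1kStar k I Q)
    (u w : TangentSpace (covelModel k I) α) : ℝ :=
  -extDerivOneForm (covelModel k I) (liouvilleForm I A) α u w

/-- The Legendre map `FL : T¹ₖQ → (T¹ₖ)*Q`: `FL(v)ᴬ(w)` is the derivative at `v` of the restriction
of `L` to the fibre `T¹ₖ_q Q` in the direction of `(0, …, w, …, 0)`, with `w` in the
`A`-th place. -/
def legendre (L : T1k k I Q → ℝ) (v : T1k k I Q) : T1kStar k I Q :=
  ⟨v.proj,
    let DL : ((Fin k → ℝ) →L[ℝ] E) →L[ℝ] ℝ :=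
      fderiv ℝ (fun u : (Fin k → ℝ) →L[ℝ] E => L ⟨v.proj, u⟩) v.snd
    let p : E →L[ℝ] (Fin k → ℝ) := ContinuousLinearMap.pi fun A =>
      DL.comp (ContinuousLinearMap.smulRightL ℝ (Fin k → ℝ) E (ContinuousLinearMap.proj A))
    p⟩

/-- The energy `E_L = C(L) - L`, with `C` the Liouville vector field, the infinitesimal generator
of the flow `(s, v) ↦ eˢ v`. -/
def energy (L : T1k k I Q → ℝ) (v : T1k k I Q) : ℝ :=
  deriv (fun s : ℝ => L ⟨v.proj, Real.exp s • v.snd⟩) 0 - L v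

/-- Structural condition, at the points of `S`: `𝒦` is a `k`-vector field along `FL`. -/
def StructuralOn (L : T1k k I Q → ℝ)
    (K : T1k k I Q → T1k k (covelModel k I) (T1kStar k I Q)) (S : Set (T1k k I Q)) : Prop :=
  ∀ v ∈ S, (K v).proj = legendre I L v

/-- Field equation condition `∑_A (FL)^*[i_{𝒦_A} ((ω₀)_A ∘ FL)] = dE_L`, at the points of `S`. -/
def FieldEquationOn (L : T1k k I Q → ℝ)
    (K : T1k k I Q → T1k k (covelModel k I) (T1kStar k I Q)) (S : Set (T1k k I Q)) : Prop :=
  ∀ v ∈ S, ∃ κ : Bundle.Trivial (T1kStar k I Q) (Fin k → ℝ) (legendre I L v) →L[ℝ]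
      TangentSpace (covelModel k I) (legendre I L v),
    K v = ⟨legendre I L v, κ⟩ ∧
      ∀ w : TangentSpace (velModel k I) v,
        ∑ A, canonicalForm I A (legendre I L v) (component (covelModel k I) κ A)
            (mfderiv (velModel k I) (covelModel k I) (legendre I L) v w)
          = mfderiv (velModel k I) 𝓘(ℝ, ℝ) (energy I L) v w

/-- Second-order condition `T¹ₖ(τ_Q^*) ∘ 𝒦 = Id`, at the points of `S`. -/
def SecondOrderOn (K : T1k k I Q → T1k k (covelModel k I) (T1kStar k I Q))
    (S : Set (T1k k I Q)) : Prop :=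
  ∀ v ∈ S, T1kMap (covelModel k I) I (tauStar I) (K v) = v

/-- Smoothness of a map `𝒦 : T¹ₖQ → T¹ₖ((T¹ₖ)*Q)`. -/
def SmoothAlong (K : T1k k I Q → T1k k (covelModel k I) (T1kStar k I Q)) : Prop :=
  ContMDiff (velModel k I) (velModel k (covelModel k I)) ∞ K

/-- Field operators associated with `L`. -/
structure IsFieldOperator (L : T1k k I Q → ℝ)
    (K : T1k k I Q → T1k k (covelModel k I) (T1kStar k I Q)) : Prop where
  smooth : SmoothAlong I K
  structural : StructuralOn I L K univ
  fieldEquation : FieldEquationOn I L K univ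
  secondOrder : SecondOrderOn I K univ

/-- `L` is almost-regular, with `𝒫 = FL(T¹ₖQ)`, `j₀ : 𝒫 → (T¹ₖ)*Q` its natural embedding as a closed
submanifold and `FL = j₀ ∘ FL₀`.  (The fibres of `FL` are those of the submersion `FL₀`, so they
are automatically closed submanifolds of `T¹ₖQ`.) -/
structure IsAlmostRegular
    {EP : Type*} [NormedAddCommGroup EP] [NormedSpace ℝ EP]
    {HP : Type*} [TopologicalSpace HP] (IP : ModelWithCorners ℝ EP HP)
    {P : Type*} [TopologicalSpace P] [ChartedSpace HP P]
    (L : T1k k I Q → ℝ) (j₀ : P → T1kStar k I Q) (FL₀ : T1k k I Q → P) : Prop where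
  smooth : ContMDiff (velModel k I) 𝓘(ℝ, ℝ) ∞ L
  embedding : IsSmoothEmbedding IP (covelModel k I) ∞ j₀
  range_eq : range j₀ = range (legendre I L)
  closed : IsClosed (range j₀)
  factor : ∀ v, j₀ (FL₀ v) = legendre I L v
  submersion : IsSubmersion (velModel k I) IP ∞ FL₀
  connected_fibre : ∀ v, IsConnected (legendre I L ⁻¹' {legendre I L v})

/-- The `k`-vector field along `FL` defined by a `k`-vector field `X₀` on `𝒫`:
`T¹ₖ(j₀) ∘ X₀ ∘ FL₀`. -/
def inducedAlong
    {EP : Type*} [NormedAddCommGroup EP] [NormedSpace ℝ EP]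
    {HP : Type*} [TopologicalSpace HP] (IP : ModelWithCorners ℝ EP HP)
    {P : Type*} [TopologicalSpace P] [ChartedSpace HP P] [IsManifold IP ∞ P]
    (j₀ : P → T1kStar k I Q) (FL₀ : T1k k I Q → P) (X₀ : KVectorField k IP P) :
    T1k k I Q → T1k k (covelModel k I) (T1kStar k I Q) :=
  fun v => T1kMap IP (covelModel k I) j₀ (X₀.toMap IP (FL₀ v))

/-- `L` is hyper-regular: `FL` is a global diffeomorphism, here with its inverse `G = FL⁻¹`. -/
structure IsHyperRegular (L : T1k k I Q → ℝ) (G : T1kStar k I Q → T1k k I Q) : Prop where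
  smooth : ContMDiff (velModel k I) 𝓘(ℝ, ℝ) ∞ L
  smooth_legendre : ContMDiff (velModel k I) (covelModel k I) ∞ (legendre I L)
  smooth_inverse : ContMDiff (covelModel k I) (velModel k I) ∞ G
  left_inv : Function.LeftInverse G (legendre I L)
  right_inv : Function.RightInverse G (legendre I L)

end Lagrangian

end KSymplectic

end

/-!
The equations for `X₀` and for the field operator are the same equation seen through `FL`.

For an almost-regular `L` one has `dE_L = dH₀ ∘ dFL₀` and `dFL = dj₀ ∘ dFL₀`, so the field equation
for `T¹ₖ(j₀) ∘ X₀ ∘ FL₀` at `v`, tested on `w`, is the Hamiltonian equation for `X₀` at `FL₀(v)`,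
tested on `dFL₀(w)`; since `FL₀` is a submersion these vectors exhaust the tangent space
(`IsAlmostRegular.fieldEquationOn_singleton_iff`).

The function `H₀` exists because the energy is basic.  Since `E_L(v) = ⟨FL(v), v⟩ - L(v)` and `FL`
is the fibre derivative of `L`, a vertical vector `w` satisfies `dE_L(w) = ⟨dFL(w), v⟩`
(`mfderiv_energy_of_vertical`).  The kernel of `dFL` is vertical, so `dE_L` vanishes on it; in
charts adapted to the submersion `FL₀` the energy is therefore constant along slices of the fibres,
hence constant on the connected fibres, and local sections of `FL₀` make the quotient function
smooth (`IsSubmersion.exists_contMDiff_factor`).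

For a hyper-regular `L` the second-order condition comes from vertical test vectors.  In canonical
coordinates `(ω₀)_A = ∑ dqⁱ ∧ dpᴬᵢ` (`canonicalForm_apply`), so on the vertical lift of `p` the left
side of the Hamiltonian equation is the pairing of `p` with the projection of `X` to `Q`, and the
right side is `dH = ⟨p, v⟩` by the formula for `dE_L`; the pairing is nondegenerate.

Without hyper-regularity these test vectors may be missing.  For `L = 0` the submanifold `𝒫` is the
zero section, all pulled-back forms and `H₀` vanish, and the zero `k`-vector field solves the
Hamiltonian equation although it does not satisfy the second-order condition.
-/

universe u

/-! ### Submersions and functions constant on their fibres -/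

namespace Manifold.IsSubmersionAt

variable {E : Type u} [NormedAddCommGroup E] [NormedSpace ℝ E]
  {H : Type*} [TopologicalSpace H] {I : ModelWithCorners ℝ E H} [I.Boundaryless]
  {M : Type*} [TopologicalSpace M] [ChartedSpace H M]
  {E' : Type*} [NormedAddCommGroup E'] [NormedSpace ℝ E']
  {H' : Type*} [TopologicalSpace H'] {J : ModelWithCorners ℝ E' H'}
  {N : Type*} [TopologicalSpace N] [ChartedSpace H' N]
  {n : WithTop ℕ∞} {f : M → N} {x : M}

/-- Around `x` a submersion is a product projection, on a product of two balls of the same radius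
(so that the slices are convex).  Here `c` is the inverse of an adapted chart, `y` the coordinate of
the base and `z` that of the fibre. -/
theorem exists_product_chart (h : IsSubmersionAt I J n f x) :
    ∃ (F : Type u) (_ : NormedAddCommGroup F) (_ : NormedSpace ℝ F)
      (c : E' × F → M) (y : N → E') (z : M → F) (r : ℝ),
      0 < r ∧ ContMDiffOn 𝓘(ℝ, E' × F) I n c
          (Metric.ball (y (f x)) r ×ˢ Metric.ball (z x) r) ∧
      ContMDiffAt J 𝓘(ℝ, E') n y (f x) ∧
      (∀ᶠ x' in 𝓝 x, y (f x') ∈ Metric.ball (y (f x)) r ∧ z x' ∈ Metric.ball (z x) r ∧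
        c (y (f x'), z x') = x') ∧
      (∀ a ∈ Metric.ball (y (f x)) r, ∀ b ∈ Metric.ball (z x) r, ∀ b' ∈ Metric.ball (z x) r,
        f (c (a, b)) = f (c (a, b'))) ∧
      ∀ᶠ y' in 𝓝 (f x), y y' ∈ Metric.ball (y (f x)) r ∧
        f (c (y y', z x)) = y' := by
  set φ := h.domChart.extend I with hφ
  set ψ := h.codChart.extend J with hψ
  have hx : x ∈ φ.source := by simpa [hφ] using h.mem_domChart_source
  have hfx : f x ∈ ψ.source := by simpa [hψ] using h.mem_codChart_source
  have hopen : IsOpen (h.equiv.symm ⁻¹' φ.target) :=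
    (h.domChart.isOpen_extend_target).preimage h.equiv.symm.continuous
  have hmem : h.equiv (φ x) ∈ h.equiv.symm ⁻¹' φ.target := by
    simpa using φ.map_source hx
  -- in the adapted charts `f` is the first projection
  have key : ∀ p ∈ h.equiv.symm ⁻¹' φ.target, ψ (f (φ.symm (h.equiv.symm p))) = p.1 ∧
      f (φ.symm (h.equiv.symm p)) ∈ ψ.source := by
    intro p hp
    refine ⟨by simpa only [Function.comp_apply, h.equiv.apply_symm_apply] using
      h.writtenInCharts hp, ?_⟩
    have : φ.symm (h.equiv.symm p) ∈ h.domChart.source := by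
      simpa [hφ] using φ.map_target hp
    simpa [hψ] using h.source_subset_preimage_source this
  have hfst : ∀ x' ∈ φ.source, (h.equiv (φ x')).1 = ψ (f x') := by
    intro x' hx'
    have := (key (h.equiv (φ x')) (by simpa using φ.map_source hx')).1
    simpa [φ.left_inv hx'] using this.symm
  obtain ⟨r, hr, hball⟩ := Metric.isOpen_iff.1 hopen _ hmem
  have hb : Metric.ball (ψ (f x)) r ×ˢ Metric.ball (h.equiv (φ x)).2 r ⊆
      h.equiv.symm ⁻¹' φ.target := by
    rw [← hfst x hx, ball_prod_same]
    exact hball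
  refine ⟨h.complement, inferInstance, inferInstance, fun p => φ.symm (h.equiv.symm p), ψ,
    fun x' => (h.equiv (φ x')).2, r, hr, ?_, ?_, ?_, ?_, ?_⟩
  · have := contMDiffOn_extend_symm h.domChart_mem_maximalAtlas
    refine this.comp (h.equiv.symm.contDiff.contMDiff.contMDiffOn) fun p hp => ?_
    rw [← OpenPartialHomeomorph.extend_target']
    exact hb hp
  · exact h.codChart.contMDiffAt_extend h.codChart_mem_maximalAtlas h.mem_codChart_source
  · have hc : ContinuousAt (fun x' => h.equiv (φ x')) x :=
      h.equiv.continuous.continuousAt.comp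
        (h.domChart.continuousAt_extend h.mem_domChart_source)
    have hs : φ.source ∈ 𝓝 x := h.domChart.extend_source_mem_nhds h.mem_domChart_source
    filter_upwards [hs, hc (Metric.ball_mem_nhds _ hr)] with x' hx' hx''
    rw [mem_preimage, ← ball_prod_same, hfst x hx] at hx''
    rw [← hfst x' hx']
    exact ⟨hx''.1, hx''.2, by simp [φ.left_inv hx']⟩
  · intro a ha b hb1 b' hb2
    obtain ⟨h1, h2⟩ := key (a, b) (hb ⟨ha, hb1⟩)
    obtain ⟨h3, h4⟩ := key (a, b') (hb ⟨ha, hb2⟩)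
    exact ψ.injOn h2 h4 (h1.trans h3.symm)
  · have hc : ContinuousAt ψ (f x) := h.codChart.continuousAt_extend h.mem_codChart_source
    have hs : ψ.source ∈ 𝓝 (f x) := h.codChart.extend_source_mem_nhds h.mem_codChart_source
    filter_upwards [hs, hc (Metric.ball_mem_nhds _ hr)] with y' hy' hy''
    obtain ⟨h1, h2⟩ := key (ψ y', (h.equiv (φ x)).2) (hb ⟨hy'', Metric.mem_ball_self hr⟩)
    exact ⟨hy'', ψ.injOn h2 hy' h1⟩

/-- A submersion has a smooth local section through every point. -/
theorem exists_localSection (h : IsSubmersionAt I J n f x) :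
    ∃ s : N → M, ContMDiffAt J I n s (f x) ∧ s (f x) = x ∧ ∀ᶠ y in 𝓝 (f x), f (s y) = y := by
  obtain ⟨F, _, _, c, y, z, r, hr, hc, hy, h1, h2, h3⟩ := h.exists_product_chart
  refine ⟨fun y' => c (y y', z x), ?_, h1.self_of_nhds.2.2, h3.mono fun _ h => h.2⟩
  have hopen : Metric.ball (y (f x)) r ×ˢ Metric.ball (z x) r ∈ 𝓝 (y (f x), z x) :=
    prod_mem_nhds (Metric.ball_mem_nhds _ hr) (Metric.ball_mem_nhds _ hr)
  refine (hc.contMDiffAt hopen).comp_of_eq (g := c) (f := fun y' => (y y', z x)) ?_ rfl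
  exact hy.prodMk_space contMDiffAt_const

theorem mfderiv_surjective (h : IsSubmersionAt I J n f x) (hn : n ≠ 0) :
    Function.Surjective (mfderiv I J f x) := by
  obtain ⟨s, hs, hsx, hfs⟩ := h.exists_localSection
  intro w
  refine ⟨mfderiv J I s (f x) w, ?_⟩
  have hf : MDifferentiableAt I J f (s (f x)) := by
    rw [hsx]; exact h.contMDiffAt.mdifferentiableAt hn
  have hcomp := mfderiv_comp (f x) hf (hs.mdifferentiableAt hn)
  have hid : mfderiv J J (f ∘ s) (f x) = mfderiv J J id (f x) :=
    Filter.EventuallyEq.mfderiv_eq hfs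
  rw [hid, mfderiv_id, hsx] at hcomp
  have := congrArg (fun T => T w) hcomp
  exact this.symm

/-- A function whose differential kills the vertical vectors of a submersion is locally constant
along its fibres. -/
theorem exists_nhds_eq_of_apply_eq (h : IsSubmersionAt I J n f x) (hn : n ≠ 0) {g : M → ℝ}
    (hf : MDifferentiable I J f) (hg : MDifferentiable I 𝓘(ℝ, ℝ) g)
    (hker : ∀ x' (w : TangentSpace I x'), mfderiv I J f x' w = 0 →
      mfderiv I 𝓘(ℝ, ℝ) g x' w = 0) :
    ∃ U ∈ 𝓝 x, ∀ x' ∈ U, ∀ x'' ∈ U, f x' = f x'' → g x' = g x'' := by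
  obtain ⟨F, _, _, c, y, z, r, hr, hc, hy, h1, h2, h3⟩ := h.exists_product_chart
  refine ⟨_, h1, ?_⟩
  rintro x' ⟨ha, hb, hx'⟩ x'' ⟨ha', hb', hx''⟩ hxx
  rw [← hx', ← hx'', ← hxx]
  set a := y (f x')
  -- `g ∘ c` is constant along the ball `{a} × B` in the fibre, as its derivative vanishes there
  have hslice : ∀ b ∈ Metric.ball (z x) r, MDifferentiableAt 𝓘(ℝ, F) I (fun b => c (a, b)) b := by
    intro b hb
    have hopen : Metric.ball (y (f x)) r ×ˢ Metric.ball (z x) r ∈ 𝓝 (a, b) :=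
      prod_mem_nhds (Metric.isOpen_ball.mem_nhds ha) (Metric.isOpen_ball.mem_nhds hb)
    refine ((hc.contMDiffAt hopen).mdifferentiableAt hn).comp b
      (f := fun b => (a, b)) ?_
    exact (DifferentiableAt.prodMk (differentiableAt_const a) differentiableAt_id).mdifferentiableAt
  have hd : ∀ b ∈ Metric.ball (z x) r, HasFDerivWithinAt (fun b => g (c (a, b))) (0 : F →L[ℝ] ℝ)
      (Metric.ball (z x) r) b := by
    intro b hb
    have e1 := mfderiv_comp b (hg (c (a, b))) (hslice b hb)
    have e2 := mfderiv_comp b (hf (c (a, b))) (hslice b hb)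
    have e3 : mfderiv 𝓘(ℝ, F) J (f ∘ fun b => c (a, b)) b = 0 := by
      have : (f ∘ fun b => c (a, b)) =ᶠ[𝓝 b] fun _ => f (c (a, b)) := by
        filter_upwards [Metric.isOpen_ball.mem_nhds hb] with b' hb'
        exact h2 a ha b' hb' b hb
      rw [this.mfderiv_eq, mfderiv_const]
    have e4 : mfderiv 𝓘(ℝ, F) 𝓘(ℝ, ℝ) (g ∘ fun b => c (a, b)) b = 0 := by
      rw [e1]
      ext w
      refine hker _ _ ?_
      rw [e3] at e2
      exact (congrArg (fun T => T w) e2).symm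
    have e5 : MDifferentiableAt 𝓘(ℝ, F) 𝓘(ℝ, ℝ) (g ∘ fun b => c (a, b)) b :=
      (hg (c (a, b))).comp b (hslice b hb)
    have e6 := e5.hasMFDerivAt
    rw [e4] at e6
    exact e6.hasFDerivAt.hasFDerivWithinAt
  exact (convex_ball (z x) r).is_const_of_fderivWithin_eq_zero (𝕜 := ℝ)
    (fun b hb => (hd b hb).differentiableWithinAt)
    (fun b hb => (hd b hb).fderivWithin (Metric.isOpen_ball.uniqueDiffWithinAt hb)) hb hb'

end Manifold.IsSubmersionAt

namespace Manifold.IsSubmersion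

variable {E : Type*} [NormedAddCommGroup E] [NormedSpace ℝ E]
  {H : Type*} [TopologicalSpace H] {I : ModelWithCorners ℝ E H} [I.Boundaryless]
  {M : Type*} [TopologicalSpace M] [ChartedSpace H M]
  {E' : Type*} [NormedAddCommGroup E'] [NormedSpace ℝ E']
  {H' : Type*} [TopologicalSpace H'] {J : ModelWithCorners ℝ E' H'}
  {N : Type*} [TopologicalSpace N] [ChartedSpace H' N]
  {n : WithTop ℕ∞} {f : M → N}

/-- A smooth function descends along a surjective submersion with connected fibres as soon as its
differential kills the vertical vectors. -/
theorem exists_contMDiff_factor (h : IsSubmersion I J n f) (hn : n ≠ 0)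
    (hsurj : Function.Surjective f) (hconn : ∀ x, IsPreconnected (f ⁻¹' {f x})) {g : M → ℝ}
    (hg : ContMDiff I 𝓘(ℝ, ℝ) n g)
    (hker : ∀ x (w : TangentSpace I x), mfderiv I J f x w = 0 →
      mfderiv I 𝓘(ℝ, ℝ) g x w = 0) :
    ∃ g₀ : N → ℝ, ContMDiff J 𝓘(ℝ, ℝ) n g₀ ∧ ∀ x, g₀ (f x) = g x := by
  have hfibre : ∀ x x', f x' = f x → g x' = g x := by
    intro x x' hx'
    have : PreconnectedSpace (f ⁻¹' {f x}) := Subtype.preconnectedSpace (hconn x)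
    have hloc : IsLocallyConstant (fun p : f ⁻¹' {f x} => g p) := by
      rw [IsLocallyConstant.iff_eventually_eq]
      rintro ⟨p, hp⟩
      obtain ⟨U, hU, hUg⟩ := (h.isSubmersionAt p).exists_nhds_eq_of_apply_eq hn
        (h.contMDiff.mdifferentiable hn) (hg.mdifferentiable hn) hker
      filter_upwards [continuous_subtype_val.continuousAt hU] with q hq
      exact hUg _ hq _ (mem_of_mem_nhds hU) (q.2.trans hp.symm)
    exact hloc.apply_eq_of_preconnectedSpace ⟨x', hx'⟩ ⟨x, rfl⟩
  refine ⟨fun y => g (Function.surjInv hsurj y), fun y => ?_,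
    fun x => hfibre _ _ (Function.surjInv_eq hsurj _)⟩
  obtain ⟨x, rfl⟩ := hsurj y
  obtain ⟨s, hs, hsx, hfs⟩ := (h.isSubmersionAt x).exists_localSection
  refine ((hg (s (f x))).comp _ hs).congr_of_eventuallyEq ?_
  filter_upwards [hfs] with y hy
  exact hfibre _ _ ((Function.surjInv_eq hsurj y).trans hy.symm)

end Manifold.IsSubmersion

/-! ### Derivatives in the total space of a bundle -/

section TotalSpace

variable {E : Type*} [NormedAddCommGroup E] [NormedSpace ℝ E]
  {H : Type*} [TopologicalSpace H] {I : ModelWithCorners ℝ E H}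
  {B : Type*} [TopologicalSpace B] [ChartedSpace H B]
  {EM : Type*} [NormedAddCommGroup EM] [NormedSpace ℝ EM]
  {HM : Type*} [TopologicalSpace HM] {IM : ModelWithCorners ℝ EM HM}
  {M : Type*} [TopologicalSpace M] [ChartedSpace HM M]
  {F : Type*} [NormedAddCommGroup F] [NormedSpace ℝ F] {V : B → Type*}
  [TopologicalSpace (TotalSpace F V)] [∀ x, TopologicalSpace (V x)] [FiberBundle F V]

/-- The derivative of a map into a bundle has as components, in the preferred chart, the derivative
of its projection to the base and that of its fibre coordinate. -/
theorem HasMFDerivAt.totalSpace {f : M → TotalSpace F V} {x₀ : M}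
    {a : TangentSpace IM x₀ →L[ℝ] E} {b : TangentSpace IM x₀ →L[ℝ] F}
    (ha : HasMFDerivAt IM I (fun x => (f x).proj) x₀ a)
    (hb : HasMFDerivAt IM 𝓘(ℝ, F) (fun x => (trivializationAt F V (f x₀).proj (f x)).2) x₀ b) :
    HasMFDerivAt IM (I.prod 𝓘(ℝ, F)) f x₀ (a.prod b) := by
  have hc : ContinuousAt f x₀ :=
    ((mdifferentiableAt_totalSpace I f).2 ⟨ha.mdifferentiableAt, hb.mdifferentiableAt⟩).continuousAt
  refine ⟨hc, ?_⟩
  refine (ha.2.prodMk hb.2).congr_of_eventuallyEq ?_ ?_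
  · have hbase : (fun x => (f x).proj) ⁻¹' (trivializationAt F V (f x₀).proj).baseSet ∈ 𝓝 x₀ :=
      ha.1 ((trivializationAt F V (f x₀).proj).open_baseSet.mem_nhds
        (mem_baseSet_trivializationAt F V _))
    have hbase' := (continuousAt_extChartAt_symm (I := IM) x₀).preimage_mem_nhds
      (by simpa only [extChartAt_to_inv] using hbase)
    filter_upwards [mem_nhdsWithin_of_mem_nhds hbase'] with y hy
    have hy' : (f ((extChartAt IM x₀).symm y)).proj ∈
        (trivializationAt F V (f x₀).proj).baseSet := hy
    simp only [writtenInExtChartAt, Function.comp_apply, FiberBundle.extChartAt,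
      PartialEquiv.trans_apply, PartialEquiv.prod_coe, PartialEquiv.refl_coe,
      OpenPartialHomeomorph.coe_toPartialEquiv, Trivialization.coe_coe, id_eq,
      Trivialization.coe_fst' _ hy', extChartAt_model_space_eq_id]
  · have hy' := mem_baseSet_trivializationAt F V (f x₀).proj
    simp only [writtenInExtChartAt, Function.comp_apply, FiberBundle.extChartAt,
      PartialEquiv.trans_apply, PartialEquiv.prod_coe, PartialEquiv.refl_coe,
      OpenPartialHomeomorph.coe_toPartialEquiv, Trivialization.coe_coe, id_eq,
      extChartAt_to_inv, Trivialization.coe_fst' _ hy', extChartAt_model_space_eq_id]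

theorem Bundle.mfderiv_proj_apply (v : TotalSpace F V) (w : TangentSpace (I.prod 𝓘(ℝ, F)) v) :
    mfderiv (I.prod 𝓘(ℝ, F)) I (TotalSpace.proj : TotalSpace F V → B) v w = (w : E × F).1 := by
  have hid : MDifferentiableAt (I.prod 𝓘(ℝ, F)) (I.prod 𝓘(ℝ, F)) (fun x : TotalSpace F V => x) v :=
    mdifferentiableAt_id
  obtain ⟨h1, h2⟩ := (mdifferentiableAt_totalSpace I _).1 hid
  have := HasMFDerivAt.totalSpace (f := fun x : TotalSpace F V => x) h1.hasMFDerivAt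
    h2.hasMFDerivAt
  have heq := hasMFDerivAt_unique this (hasMFDerivAt_id v)
  exact congrArg (fun T => (T w : E × F).1) heq

end TotalSpace

noncomputable section

namespace KSymplectic

/-! ### Fibre coordinates of velocities and covelocities -/

section Coordinates

variable {k : ℕ}
  {E : Type*} [NormedAddCommGroup E] [NormedSpace ℝ E]
  {H : Type*} [TopologicalSpace H] {I : ModelWithCorners ℝ E H}
  {Q : Type*} [TopologicalSpace Q] [ChartedSpace H Q] [IsManifold I ∞ Q]

theorem T1k.trivializationAt_snd {q₀ : Q} {v : T1k k I Q} (hv : v.proj ∈ (chartAt H q₀).source) :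
    (trivializationAt ((Fin k → ℝ) →L[ℝ] E)
      (fun x : Q => Bundle.Trivial Q (Fin k → ℝ) x →L[ℝ] TangentSpace I x) q₀ v).2 =
    (mfderiv I 𝓘(ℝ, E) (extChartAt I q₀) v.proj).comp v.2 := by
  refine (congrArg Prod.snd (hom_trivializationAt_apply ..)).trans ?_
  rw [ContinuousLinearMap.inCoordinates, TangentBundle.continuousLinearMapAt_trivializationAt hv]
  ext1 x
  simp only [Trivial.fiberBundle_trivializationAt', Trivial.symmL_trivialization]
  rfl

theorem T1kStar.trivializationAt_snd {q₀ : Q} {α : T1kStar k I Q}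
    (hα : α.proj ∈ (chartAt H q₀).source) :
    (trivializationAt (E →L[ℝ] (Fin k → ℝ))
      (fun x : Q => TangentSpace I x →L[ℝ] Bundle.Trivial Q (Fin k → ℝ) x) q₀ α).2 =
    α.2.comp (mfderivWithin 𝓘(ℝ, E) I (extChartAt I q₀).symm (range I)
      (extChartAt I q₀ α.proj)) := by
  refine (congrArg Prod.snd (hom_trivializationAt_apply ..)).trans ?_
  rw [ContinuousLinearMap.inCoordinates, TangentBundle.symmL_trivializationAt hα]
  ext1 x
  simp only [Trivial.fiberBundle_trivializationAt', Trivial.continuousLinearMapAt_trivialization]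
  rfl

/-- The trivialization attached to `q` is the identity on the fibre over `q`, which is why the fibre
can be worked with as the model space. -/
theorem T1k.trivializationAt_self {q : Q} (u : (Fin k → ℝ) →L[ℝ] E) :
    (trivializationAt ((Fin k → ℝ) →L[ℝ] E)
      (fun x : Q => Bundle.Trivial Q (Fin k → ℝ) x →L[ℝ] TangentSpace I x) q
      (⟨q, u⟩ : T1k k I Q)).2 = u := by
  rw [T1k.trivializationAt_snd (mem_chart_source H q), mfderiv_extChartAt_self]
  rfl

theorem T1kStar.trivializationAt_self {q : Q} (p : E →L[ℝ] (Fin k → ℝ)) :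
    (trivializationAt (E →L[ℝ] (Fin k → ℝ))
      (fun x : Q => TangentSpace I x →L[ℝ] Bundle.Trivial Q (Fin k → ℝ) x) q
      (⟨q, p⟩ : T1kStar k I Q)).2 = p := by
  rw [T1kStar.trivializationAt_snd (mem_chart_source H q), mfderivWithin_range_extChartAt_symm]
  rfl

theorem contMDiff_fibre_T1k (q : Q) :
    ContMDiff 𝓘(ℝ, (Fin k → ℝ) →L[ℝ] E) (velModel k I) ∞
      (fun u : (Fin k → ℝ) →L[ℝ] E => (⟨q, u⟩ : T1k k I Q)) := by
  intro u
  refine contMDiffAt_totalSpace.2 ⟨contMDiffAt_const, ?_⟩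
  exact contMDiffAt_id.congr_of_eventuallyEq
    (Filter.Eventually.of_forall fun u => T1k.trivializationAt_self u)

theorem hasMFDerivAt_fibre_T1k (q : Q) {G : Type*} [NormedAddCommGroup G] [NormedSpace ℝ G]
    {u : G → (Fin k → ℝ) →L[ℝ] E} {u' : G →L[ℝ] (Fin k → ℝ) →L[ℝ] E} {x : G}
    (hu : HasFDerivAt u u' x) :
    HasMFDerivAt 𝓘(ℝ, G) (velModel k I) (fun x => (⟨q, u x⟩ : T1k k I Q)) x
      ((0 : G →L[ℝ] E).prod u') :=
  HasMFDerivAt.totalSpace (hasMFDerivAt_const q x)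
    (hu.hasMFDerivAt.congr_of_eventuallyEq
      (Filter.Eventually.of_forall fun x => T1k.trivializationAt_self (u x)))

theorem hasMFDerivAt_fibre_T1kStar (q : Q) {G : Type*} [NormedAddCommGroup G] [NormedSpace ℝ G]
    {p : G → E →L[ℝ] (Fin k → ℝ)} {p' : G →L[ℝ] E →L[ℝ] (Fin k → ℝ)} {x : G}
    (hp : HasFDerivAt p p' x) :
    HasMFDerivAt 𝓘(ℝ, G) (covelModel k I) (fun x => (⟨q, p x⟩ : T1kStar k I Q)) x
      ((0 : G →L[ℝ] E).prod p') :=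
  HasMFDerivAt.totalSpace (hasMFDerivAt_const q x)
    (hp.hasMFDerivAt.congr_of_eventuallyEq
      (Filter.Eventually.of_forall fun x => T1kStar.trivializationAt_self (p x)))

end Coordinates

/-! ### The duality between velocities and covelocities -/

section Pairing

variable {k : ℕ} {E : Type*} [NormedAddCommGroup E] [NormedSpace ℝ E]

/-- The duality `⟨p, u⟩ = ∑_A pᴬ(u_A)` between the fibres of `(T¹ₖ)*Q` and `T¹ₖQ`. -/
def pairing (p : E →L[ℝ] (Fin k → ℝ)) (u : (Fin k → ℝ) →L[ℝ] E) : ℝ :=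
  ∑ A, p (u (Pi.single A 1)) A

theorem contDiff_pairing {n : WithTop ℕ∞} :
    ContDiff ℝ n fun z : (E →L[ℝ] (Fin k → ℝ)) × ((Fin k → ℝ) →L[ℝ] E) => pairing z.1 z.2 := by
  refine ContDiff.sum fun A _ => ?_
  refine (contDiff_apply ℝ ℝ A).comp ?_
  exact contDiff_fst.clm_apply (contDiff_snd.clm_apply contDiff_const)

theorem hasDerivAt_pairing {p : ℝ → E →L[ℝ] (Fin k → ℝ)} {p' : E →L[ℝ] (Fin k → ℝ)}
    {u : ℝ → (Fin k → ℝ) →L[ℝ] E} {u' : (Fin k → ℝ) →L[ℝ] E} {t : ℝ}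
    (hp : HasDerivAt p p' t) (hu : HasDerivAt u u' t) :
    HasDerivAt (fun s => pairing (p s) (u s)) (pairing p' (u t) + pairing (p t) u') t := by
  have hsum : pairing p' (u t) + pairing (p t) u' =
      ∑ A, (p' (u t (Pi.single A 1)) + p t (u' (Pi.single A 1))) A := by
    simp only [pairing, Pi.add_apply, Finset.sum_add_distrib]
  rw [hsum]
  refine HasDerivAt.fun_sum fun A _ => ?_
  have h1 : HasDerivAt (fun s => u s (Pi.single A 1)) (u' (Pi.single A 1)) t := by
    simpa using hu.clm_apply (hasDerivAt_const t (Pi.single A (1 : ℝ) : Fin k → ℝ))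
  exact hasDerivAt_pi.1 (hp.clm_apply h1) A

theorem eq_zero_of_pairing_eq_zero {u : (Fin k → ℝ) →L[ℝ] E} (h : ∀ p, pairing p u = 0) :
    u = 0 := by
  have hA : ∀ A, u (Pi.single A 1) = 0 := by
    intro A
    by_contra hne
    obtain ⟨ℓ, hℓ⟩ := SeparatingDual.exists_ne_zero (R := ℝ) hne
    refine hℓ ?_
    have := h (ContinuousLinearMap.smulRight ℓ (Pi.single A 1))
    simpa [pairing, Pi.single_apply] using this
  ext x
  rw [zero_apply, ← Finset.univ_sum_single x, map_sum]
  refine Finset.sum_eq_zero fun A _ => ?_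
  rw [show Pi.single A (x A) = x A • (Pi.single A (1 : ℝ) : Fin k → ℝ) by simp [← Pi.single_smul],
    map_smul, hA, smul_zero]

/-- The covelocity whose components are the partial derivatives, in each of the `k` vectors, of a
function with derivative `D`. -/
def partials (D : ((Fin k → ℝ) →L[ℝ] E) →L[ℝ] ℝ) : E →L[ℝ] (Fin k → ℝ) :=
  ContinuousLinearMap.pi fun A =>
    D.comp (ContinuousLinearMap.smulRightL ℝ (Fin k → ℝ) E (ContinuousLinearMap.proj A))

theorem pairing_partials (D : ((Fin k → ℝ) →L[ℝ] E) →L[ℝ] ℝ) (u : (Fin k → ℝ) →L[ℝ] E) :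
    pairing (partials D) u = D u := by
  have hu : u = ∑ A, ContinuousLinearMap.smulRightL ℝ (Fin k → ℝ) E
      (ContinuousLinearMap.proj A) (u (Pi.single A 1)) := by
    ext x
    conv_lhs => rw [← Finset.univ_sum_single x, map_sum]
    rw [sum_apply]
    refine Finset.sum_congr rfl fun A _ => ?_
    rw [show Pi.single A (x A) = x A • (Pi.single A (1 : ℝ) : Fin k → ℝ) by
      simp [← Pi.single_smul], map_smul]
    rfl
  conv_rhs => rw [hu, map_sum]
  rfl

end Pairing

/-! ### The Legendre map and the energy -/

section Legendre

variable {k : ℕ}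
  {E : Type*} [NormedAddCommGroup E] [NormedSpace ℝ E]
  {H : Type*} [TopologicalSpace H] {I : ModelWithCorners ℝ E H}
  {Q : Type*} [TopologicalSpace Q] [ChartedSpace H Q] [IsManifold I ∞ Q]
  {L : T1k k I Q → ℝ}

theorem contDiff_fibre (hL : ContMDiff (velModel k I) 𝓘(ℝ, ℝ) ∞ L) (q : Q) :
    ContDiff ℝ ∞ (fun u : (Fin k → ℝ) →L[ℝ] E => L ⟨q, u⟩) :=
  (hL.comp (contMDiff_fibre_T1k q)).contDiff

theorem energy_mk (hL : ContMDiff (velModel k I) 𝓘(ℝ, ℝ) ∞ L) (q : Q)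
    (u : (Fin k → ℝ) →L[ℝ] E) :
    energy I L ⟨q, u⟩ =
      pairing (partials (fderiv ℝ (fun u : (Fin k → ℝ) →L[ℝ] E => L ⟨q, u⟩) u)) u - L ⟨q, u⟩ := by
  have hd : HasFDerivAt (fun u : (Fin k → ℝ) →L[ℝ] E => L ⟨q, u⟩)
      (fderiv ℝ (fun u : (Fin k → ℝ) →L[ℝ] E => L ⟨q, u⟩) u) (Real.exp 0 • u) := by
    rw [Real.exp_zero, one_smul]
    exact ((contDiff_fibre hL q).differentiable (by simp) u).hasFDerivAt
  have hs : HasDerivAt (fun s : ℝ => Real.exp s • u) (Real.exp 0 • u) 0 :=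
    (Real.hasDerivAt_exp 0).smul_const u
  have hcomp := (hd.comp_hasDerivAt (0 : ℝ) hs).deriv
  rw [Real.exp_zero, one_smul] at hcomp
  rw [pairing_partials]
  exact congrArg (· - L ⟨q, u⟩) hcomp

/-- `E_L(v) = ⟨FL(v), v⟩ - L(v)`. -/
theorem energy_eq (hL : ContMDiff (velModel k I) 𝓘(ℝ, ℝ) ∞ L) (v : T1k k I Q) :
    energy I L v = pairing (E := E) (legendre I L v).2 v.2 - L v :=
  energy_mk hL v.1 v.2

/-- The duality pairing may be computed in any chart of the base. -/
theorem pairing_trivializationAt {q₀ q : Q} (hq : q ∈ (chartAt H q₀).source)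
    (p : E →L[ℝ] (Fin k → ℝ)) (u : (Fin k → ℝ) →L[ℝ] E) :
    pairing (trivializationAt (E →L[ℝ] (Fin k → ℝ))
        (fun x : Q => TangentSpace I x →L[ℝ] Bundle.Trivial Q (Fin k → ℝ) x) q₀
        (⟨q, p⟩ : T1kStar k I Q)).2
      (trivializationAt ((Fin k → ℝ) →L[ℝ] E)
        (fun x : Q => Bundle.Trivial Q (Fin k → ℝ) x →L[ℝ] TangentSpace I x) q₀
        (⟨q, u⟩ : T1k k I Q)).2 =
    pairing p u := by
  have hinv := mfderivWithin_extChartAt_symm_comp_mfderiv_extChartAt' (I := I)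
    (x := q₀) (y := q) (by simpa using hq)
  refine Finset.sum_congr rfl fun A _ => ?_
  rw [T1k.trivializationAt_snd hq, T1kStar.trivializationAt_snd hq]
  exact congrArg (fun T : TangentSpace I q →L[ℝ] TangentSpace I q =>
    p (T (u (Pi.single A 1))) A) hinv

theorem contMDiff_energy (hL : ContMDiff (velModel k I) 𝓘(ℝ, ℝ) ∞ L)
    (hFL : ContMDiff (velModel k I) (covelModel k I) ∞ (legendre I L)) :
    ContMDiff (velModel k I) 𝓘(ℝ, ℝ) ∞ (energy I L) := by
  intro v₀
  have h1 := (contMDiffAt_totalSpace.1 (hFL v₀)).2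
  have hid : ContMDiffAt (velModel k I) (velModel k I) ∞ (fun v : T1k k I Q => v) v₀ :=
    contMDiffAt_id
  obtain ⟨h2, h3⟩ := contMDiffAt_totalSpace.1 hid
  have h4 := (contDiff_pairing (k := k) (E := E)).contMDiff.contMDiffAt.comp v₀
    (h1.prodMk_space h3)
  refine (h4.sub (hL v₀)).congr_of_eventuallyEq ?_
  filter_upwards [h2.continuousAt ((chartAt H v₀.proj).open_source.mem_nhds
    (mem_chart_source H v₀.proj))] with v hv
  rw [energy_eq hL]
  exact congrArg (· - L v)
    (pairing_trivializationAt (k := k) (E := E) hv (legendre I L v).2 v.2).symm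

/-- The formula `dE_L(δ) = ⟨dFL(δ), v⟩` for the velocity `δ` of a curve in a fibre of `T¹ₖQ`: along
the curve `E_L` is `⟨FL(v), v⟩ - L(v)`, and in its derivative the terms `⟨FL(v), δ⟩` and `dL(δ)`
cancel. -/
theorem mfderiv_energy_curve (hL : ContMDiff (velModel k I) 𝓘(ℝ, ℝ) ∞ L)
    (hFL : ContMDiff (velModel k I) (covelModel k I) ∞ (legendre I L)) (q : Q)
    {c : ℝ → (Fin k → ℝ) →L[ℝ] E} {δ : (Fin k → ℝ) →L[ℝ] E} (hc : HasDerivAt c δ 0) :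
    mfderiv (velModel k I) 𝓘(ℝ, ℝ) (energy I L) ⟨q, c 0⟩ ((0, δ) : E × ((Fin k → ℝ) →L[ℝ] E)) =
      pairing (mfderiv (velModel k I) (covelModel k I) (legendre I L) ⟨q, c 0⟩
        ((0, δ) : E × ((Fin k → ℝ) →L[ℝ] E)) : E × (E →L[ℝ] (Fin k → ℝ))).2 (c 0) := by
  let ℓ : ((Fin k → ℝ) →L[ℝ] E) → ℝ := fun u => L ⟨q, u⟩
  have hι := hasMFDerivAt_fibre_T1k (I := I) q hc.hasFDerivAt
  have hP : DifferentiableAt ℝ (fun t => partials (fderiv ℝ ℓ (c t))) 0 := by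
    have h1 : ContMDiff 𝓘(ℝ, (Fin k → ℝ) →L[ℝ] E) (covelModel k I) ∞
        (fun u : (Fin k → ℝ) →L[ℝ] E => legendre I L ⟨q, u⟩) :=
      hFL.comp (contMDiff_fibre_T1k q)
    have h2 := (contMDiffAt_totalSpace.1 (h1 (c 0))).2.contDiffAt
    have h3 : ContDiffAt ℝ ∞ (fun u => partials (fderiv ℝ ℓ u)) (c 0) :=
      h2.congr_of_eventuallyEq
        (Filter.Eventually.of_forall fun u => (T1kStar.trivializationAt_self _).symm)
    exact (h3.differentiableAt (by simp)).comp 0 hc.differentiableAt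
  set P' := deriv (fun t => partials (fderiv ℝ ℓ (c t))) 0
  have hleg : mfderiv (velModel k I) (covelModel k I) (legendre I L) ⟨q, c 0⟩
      ((0, δ) : E × ((Fin k → ℝ) →L[ℝ] E)) = ((0, P') : E × (E →L[ℝ] (Fin k → ℝ))) := by
    have h1 := (hFL.mdifferentiable (by simp) ⟨q, c 0⟩).hasMFDerivAt.comp 0 hι
    have h2 := congrArg (fun T => T (1 : ℝ))
      (hasMFDerivAt_unique h1 (hasMFDerivAt_fibre_T1kStar q hP.hasDerivAt.hasFDerivAt))
    have h3 : mfderiv (velModel k I) (covelModel k I) (legendre I L) ⟨q, c 0⟩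
      ((0, (1 : ℝ) • δ) : E × ((Fin k → ℝ) →L[ℝ] E)) =
        ((0, (1 : ℝ) • P') : E × (E →L[ℝ] (Fin k → ℝ))) := h2
    rwa [one_smul, one_smul] at h3
  have hen : mfderiv (velModel k I) 𝓘(ℝ, ℝ) (energy I L) ⟨q, c 0⟩
      ((0, δ) : E × ((Fin k → ℝ) →L[ℝ] E)) = pairing P' (c 0) := by
    have h1 := ((contMDiff_energy hL hFL).mdifferentiable (by simp) ⟨q, c 0⟩).hasMFDerivAt.comp 0 hι
    have h2 : HasDerivAt (fun t => pairing (partials (fderiv ℝ ℓ (c t))) (c t) - ℓ (c t))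
        (pairing P' (c 0) + pairing (partials (fderiv ℝ ℓ (c 0))) δ - fderiv ℝ ℓ (c 0) δ) 0 :=
      (hasDerivAt_pairing hP.hasDerivAt hc).sub
        (((contDiff_fibre hL q).differentiable (by simp) (c 0)).hasFDerivAt.comp_hasDerivAt 0 hc)
    rw [pairing_partials, add_sub_cancel_right] at h2
    have h3 : (energy I L ∘ fun t => (⟨q, c t⟩ : T1k k I Q)) =
        fun t => pairing (partials (fderiv ℝ ℓ (c t))) (c t) - ℓ (c t) :=
      funext fun t => energy_mk hL q (c t)
    rw [h3] at h1
    have h4 : mfderiv (velModel k I) 𝓘(ℝ, ℝ) (energy I L) ⟨q, c 0⟩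
      ((0, (1 : ℝ) • δ) : E × ((Fin k → ℝ) →L[ℝ] E)) = (1 : ℝ) • pairing P' (c 0) :=
      congrArg (fun T => T (1 : ℝ)) (hasMFDerivAt_unique h1 h2.hasFDerivAt.hasMFDerivAt)
    rwa [one_smul, one_smul] at h4
  rw [hen, hleg]

/-- On vertical vectors the differential of the energy is the variation of the momenta, paired with
the velocities. -/
theorem mfderiv_energy_of_vertical (hL : ContMDiff (velModel k I) 𝓘(ℝ, ℝ) ∞ L)
    (hFL : ContMDiff (velModel k I) (covelModel k I) ∞ (legendre I L)) (v : T1k k I Q)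
    (w : TangentSpace (velModel k I) v) (hw : (w : E × ((Fin k → ℝ) →L[ℝ] E)).1 = 0) :
    mfderiv (velModel k I) 𝓘(ℝ, ℝ) (energy I L) v w =
      pairing (mfderiv (velModel k I) (covelModel k I) (legendre I L) v w :
        E × (E →L[ℝ] (Fin k → ℝ))).2 (v.2 : (Fin k → ℝ) →L[ℝ] E) := by
  let u : (Fin k → ℝ) →L[ℝ] E := v.2
  let δ : (Fin k → ℝ) →L[ℝ] E := (w : E × ((Fin k → ℝ) →L[ℝ] E)).2
  obtain ⟨c, hc0, hc⟩ : ∃ c : ℝ → (Fin k → ℝ) →L[ℝ] E, c 0 = u ∧ HasDerivAt c δ 0 := by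
    refine ⟨fun t => u + t • δ, by simp, ?_⟩
    have := ((hasDerivAt_id (0 : ℝ)).smul_const δ).const_add u
    rwa [one_smul] at this
  have hw' : w = ((0, δ) : E × ((Fin k → ℝ) →L[ℝ] E)) := Prod.ext hw rfl
  have := mfderiv_energy_curve hL hFL v.1 hc
  rw [hc0] at this
  rw [hw']
  exact this

end Legendre

end KSymplectic

end

/-! ### The projection and the zero section of a vector bundle -/

section Bundles

variable {E : Type*} [NormedAddCommGroup E] [NormedSpace ℝ E]
  {H : Type*} [TopologicalSpace H] {I : ModelWithCorners ℝ E H}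
  {B : Type*} [TopologicalSpace B] [ChartedSpace H B]
  {F : Type*} [NormedAddCommGroup F] [NormedSpace ℝ F] {V : B → Type*}
  [TopologicalSpace (TotalSpace F V)] [∀ x, TopologicalSpace (V x)] [FiberBundle F V]

theorem Bundle.proj_extChartAt_symm (v : TotalSpace F V) {y : E × F}
    (hy : y ∈ (extChartAt (I.prod 𝓘(ℝ, F)) v).target) :
    ((extChartAt (I.prod 𝓘(ℝ, F)) v).symm y).proj = (extChartAt I v.proj).symm y.1 := by
  rw [FiberBundle.extChartAt_target] at hy
  rw [FiberBundle.extChartAt]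
  exact Trivialization.proj_symm_apply' _ hy.1.2

theorem Bundle.isSubmersion_proj {n : WithTop ℕ∞} [IsManifold I n B]
    [IsManifold (I.prod 𝓘(ℝ, F)) n (TotalSpace F V)] :
    IsSubmersion (I.prod 𝓘(ℝ, F)) I n (TotalSpace.proj : TotalSpace F V → B) := by
  refine IsSubmersionOfComplement.isSubmersion (F := F) fun v => ?_
  refine IsSubmersionAtOfComplement.mk_of_continuousAt
    (FiberBundle.continuous_proj F V).continuousAt (ContinuousLinearEquiv.refl ℝ (E × F))
    (chartAt (ModelProd H F) v) (chartAt H v.proj) (mem_chart_source _ v)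
    (mem_chart_source H v.proj)
    (IsManifold.chart_mem_maximalAtlas v) (IsManifold.chart_mem_maximalAtlas v.proj) fun y hy => ?_
  have h1 := Bundle.proj_extChartAt_symm v hy
  refine (congrArg (extChartAt I v.proj) h1).trans ?_
  refine (extChartAt I v.proj).right_inv ?_
  have h2 : y ∈ (extChartAt (I.prod 𝓘(ℝ, F)) v).target := hy
  rw [FiberBundle.extChartAt_target] at h2
  exact h2.1.1

variable [∀ x, AddCommGroup (V x)] [∀ x, Module ℝ (V x)] [VectorBundle ℝ F V]

theorem Bundle.isImmersion_zeroSection {n : WithTop ℕ∞} [IsManifold I n B]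
    [ContMDiffVectorBundle n F V I] :
    IsImmersion I (I.prod 𝓘(ℝ, F)) n (zeroSection F V) := by
  refine IsImmersionOfComplement.isImmersion (F := F) fun x => ?_
  set e := trivializationAt F V x
  -- the base chart has to be shrunk to the domain of the trivialization
  refine IsImmersionAtOfComplement.mk_of_continuousAt
    (contMDiff_zeroSection ℝ V (IB := I) (n := n)).continuous.continuousAt
    (ContinuousLinearEquiv.refl ℝ (E × F)) ((chartAt H x).restr e.baseSet)
    (chartAt (ModelProd H F) (zeroSection F V x)) ?_ (mem_chart_source _ (zeroSection F V x))
    (restr_mem_maximalAtlas _ (IsManifold.chart_mem_maximalAtlas x) e.open_baseSet)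
    (IsManifold.chart_mem_maximalAtlas (zeroSection F V x)) fun y hy => ?_
  · rw [OpenPartialHomeomorph.restr_source' _ _ e.open_baseSet]
    exact ⟨mem_chart_source H x, mem_baseSet_trivializationAt F V x⟩
  · rw [OpenPartialHomeomorph.extend_target] at hy
    obtain ⟨⟨hy1, hy2⟩, hy3⟩ := hy
    have hyb : (extChartAt I x).symm y ∈ e.baseSet := by
      rw [e.open_baseSet.interior_eq] at hy2
      exact hy2
    have hyt : y ∈ (extChartAt I x).target := by
      rw [extChartAt_target]
      exact ⟨hy1, hy3⟩
    have h1 : extChartAt (I.prod 𝓘(ℝ, F)) (zeroSection F V x)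
        (zeroSection F V ((extChartAt I x).symm y)) = (y, 0) := by
      rw [FiberBundle.extChartAt]
      refine (congrArg ((extChartAt I x).prod (PartialEquiv.refl F)) (e.zeroSection ℝ hyb)).trans ?_
      exact Prod.ext ((extChartAt I x).right_inv hyt) rfl
    exact h1

theorem Bundle.isClosed_range_zeroSection : IsClosed (range (zeroSection F V)) := by
  rw [← isOpen_compl_iff, isOpen_iff_mem_nhds]
  intro v hv
  set e := trivializationAt F V v.proj
  have hve : v ∈ e.source := FiberBundle.mem_trivializationAt_proj_source
  have hev : (e v).2 ≠ 0 := by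
    intro h0
    have hz : zeroSection F V v.proj ∈ e.source :=
      e.mem_source.2 (mem_baseSet_trivializationAt F V v.proj)
    refine hv ⟨v.proj, e.injOn hz hve ?_⟩
    exact (e.zeroSection ℝ (mem_baseSet_trivializationAt F V v.proj)).trans
      (Prod.ext (e.coe_fst hve).symm h0.symm)
  have hc : ContinuousAt (fun w => (e w).2) v :=
    continuous_snd.continuousAt.comp (e.continuousOn.continuousAt (e.open_source.mem_nhds hve))
  filter_upwards [hc (isOpen_ne.mem_nhds hev), e.open_source.mem_nhds hve] with w hw hwe
  rintro ⟨b, rfl⟩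
  exact hw (congrArg Prod.snd (e.zeroSection ℝ (e.mem_source.1 hwe)))

end Bundles

noncomputable section

namespace KSymplectic

/-! ### The canonical forms in coordinates, and smoothness of `T¹ₖ(f)` -/

section CanonicalForms

variable {k : ℕ}
  {E : Type*} [NormedAddCommGroup E] [NormedSpace ℝ E]
  {H : Type*} [TopologicalSpace H] {I : ModelWithCorners ℝ E H}
  {Q : Type*} [TopologicalSpace Q] [ChartedSpace H Q] [IsManifold I ∞ Q]

/-- In canonical coordinates `(θ₀)_A = ∑ pᴬᵢ dqⁱ`. -/
theorem oneFormInChart_liouvilleForm (A : Fin k) (α : T1kStar k I Q)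
    {y : E × (E →L[ℝ] (Fin k → ℝ))} (hy : y ∈ (extChartAt (covelModel k I) α).target) :
    oneFormInChart (covelModel k I) (liouvilleForm I A) α y =
      ((ContinuousLinearMap.proj (R := ℝ) (φ := fun _ : Fin k => ℝ) A).comp y.2).comp
        (ContinuousLinearMap.fst ℝ E (E →L[ℝ] (Fin k → ℝ))) := by
  set z := (extChartAt (covelModel k I) α).symm y with hz
  have hzp : z.proj = (extChartAt I α.proj).symm y.1 := Bundle.proj_extChartAt_symm α hy
  have hy1 : y.1 ∈ (extChartAt I α.proj).target := by
    have h2 := hy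
    rw [FiberBundle.extChartAt_target] at h2
    exact h2.1.1
  have hzs : z.proj ∈ (chartAt H α.proj).source := by
    rw [hzp, ← extChartAt_source I]
    exact (extChartAt I α.proj).map_target hy1
  have hzy : extChartAt I α.proj z.proj = y.1 := by
    rw [hzp, (extChartAt I α.proj).right_inv hy1]
  let d : E → E →L[ℝ] E := fun y' =>
    mfderivWithin 𝓘(ℝ, E) I (extChartAt I α.proj).symm (range I) y'
  let p : E →L[ℝ] (Fin k → ℝ) := z.2
  have hy2 : y.2 = p.comp (d y.1) := by
    have h1 := (extChartAt (covelModel k I) α).right_inv hy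
    rw [← hz, FiberBundle.extChartAt] at h1
    have h2 : p.comp (d (extChartAt I α.proj z.proj)) = y.2 :=
      (T1kStar.trivializationAt_snd hzs).symm.trans (congrArg Prod.snd h1)
    rw [← h2, hzy]
  -- in the chart, the projection to the base is the first projection
  have hτ : (mfderiv (covelModel k I) I (tauStar (k := k) I (Q := Q)) z :
        E × (E →L[ℝ] (Fin k → ℝ)) →L[ℝ] E).comp
      (mfderivWithin 𝓘(ℝ, E × (E →L[ℝ] (Fin k → ℝ))) (covelModel k I)
        (extChartAt (covelModel k I) α).symm (range (covelModel k I)) y :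
        E × (E →L[ℝ] (Fin k → ℝ)) →L[ℝ] E × (E →L[ℝ] (Fin k → ℝ))) =
      (d y.1).comp (ContinuousLinearMap.fst ℝ E (E →L[ℝ] (Fin k → ℝ))) := by
    have hu : UniqueMDiffWithinAt 𝓘(ℝ, E × (E →L[ℝ] (Fin k → ℝ))) (range (covelModel k I)) y :=
      (covelModel k I).uniqueMDiffOn y (extChartAt_target_subset_range α hy)
    have h1 := mfderiv_comp_mfderivWithin y
      (Bundle.mdifferentiableAt_proj _ : MDifferentiableAt (covelModel k I) I
        (tauStar (k := k) I (Q := Q)) z)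
      (mdifferentiableWithinAt_extChartAt_symm hy) hu
    refine h1.symm.trans ?_
    have h2 : (tauStar (k := k) I (Q := Q) ∘ (extChartAt (covelModel k I) α).symm)
        =ᶠ[𝓝[range (covelModel k I)] y] (extChartAt I α.proj).symm ∘ Prod.fst := by
      filter_upwards [extChartAt_target_mem_nhdsWithin_of_mem hy] with y' hy'
      exact Bundle.proj_extChartAt_symm α hy'
    have h3 : MDifferentiableWithinAt 𝓘(ℝ, E × (E →L[ℝ] (Fin k → ℝ))) 𝓘(ℝ, E)
        (Prod.fst : E × (E →L[ℝ] (Fin k → ℝ)) → E) (range (covelModel k I)) y :=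
      differentiableWithinAt_fst.mdifferentiableWithinAt
    have h4 : range (covelModel k I) ⊆ Prod.fst ⁻¹' range I := by
      rintro _ ⟨x, rfl⟩
      exact ⟨x.1, rfl⟩
    refine (h2.mfderivWithin_eq_of_mem (extChartAt_target_subset_range α hy)).trans ?_
    refine (mfderivWithin_comp y (mdifferentiableWithinAt_extChartAt_symm hy1) h3 h4 hu).trans ?_
    have h5 : mfderivWithin 𝓘(ℝ, E × (E →L[ℝ] (Fin k → ℝ))) 𝓘(ℝ, E)
        (Prod.fst : E × (E →L[ℝ] (Fin k → ℝ)) → E) (range (covelModel k I)) y =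
        ContinuousLinearMap.fst ℝ E (E →L[ℝ] (Fin k → ℝ)) := by
      rw [mfderivWithin_eq_fderivWithin]
      exact fderivWithin_fst hu.uniqueDiffWithinAt
    exact congrArg (fun T : E × (E →L[ℝ] (Fin k → ℝ)) →L[ℝ] E => (d y.1).comp T) h5
  rw [hy2]
  exact congrArg (fun T : E × (E →L[ℝ] (Fin k → ℝ)) →L[ℝ] E =>
    ((ContinuousLinearMap.proj (R := ℝ) (φ := fun _ : Fin k => ℝ) A).comp p).comp T)
    hτ

set_option synthInstance.maxHeartbeats 200000 in
/-- In canonical coordinates `(ω₀)_A = ∑ dqⁱ ∧ dpᴬᵢ`. -/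
theorem canonicalForm_apply (A : Fin k) (α : T1kStar k I Q)
    (u w : TangentSpace (covelModel k I) α) :
    canonicalForm I A α u w =
      (w : E × (E →L[ℝ] (Fin k → ℝ))).2 (u : E × (E →L[ℝ] (Fin k → ℝ))).1 A -
      (u : E × (E →L[ℝ] (Fin k → ℝ))).2 (w : E × (E →L[ℝ] (Fin k → ℝ))).1 A := by
  have hΛ : IsBoundedLinearMap ℝ fun y : E × (E →L[ℝ] (Fin k → ℝ)) =>
      ((ContinuousLinearMap.proj (R := ℝ) (φ := fun _ : Fin k => ℝ) A).comp y.2).comp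
        (ContinuousLinearMap.fst ℝ E (E →L[ℝ] (Fin k → ℝ))) := by
    refine IsLinearMap.with_bound ⟨fun _ _ => rfl, fun _ _ => rfl⟩ 1 fun y => ?_
    rw [one_mul]
    refine ContinuousLinearMap.opNorm_le_bound _ (norm_nonneg y) fun x => ?_
    calc ‖y.2 x.1 A‖ ≤ ‖y.2 x.1‖ := norm_le_pi_norm _ A
      _ ≤ ‖y.2‖ * ‖x.1‖ := y.2.le_opNorm _
      _ ≤ ‖y‖ * ‖x‖ := by gcongr; exacts [norm_snd_le y, norm_fst_le x]
  have hx := mem_extChartAt_target (I := covelModel k I) α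
  have hD : HasFDerivWithinAt (oneFormInChart (covelModel k I) (liouvilleForm I A) α)
      hΛ.toContinuousLinearMap (range (covelModel k I)) (extChartAt (covelModel k I) α α) := by
    refine hΛ.hasFDerivAt.hasFDerivWithinAt.congr_of_eventuallyEq ?_
      (oneFormInChart_liouvilleForm A α hx)
    filter_upwards [extChartAt_target_mem_nhdsWithin α] with y hy
    exact oneFormInChart_liouvilleForm A α hy
  have hD' := hD.fderivWithin ((covelModel k I).uniqueDiffOn _
    (extChartAt_target_subset_range α hx))
  rw [canonicalForm, extDerivOneForm, hD', mfderiv_extChartAt_self]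
  change -((u : E × (E →L[ℝ] (Fin k → ℝ))).2 (w : E × (E →L[ℝ] (Fin k → ℝ))).1 A -
    (w : E × (E →L[ℝ] (Fin k → ℝ))).2 (u : E × (E →L[ℝ] (Fin k → ℝ))).1 A) = _
  ring

theorem contMDiff_T1kMap
    {E' : Type*} [NormedAddCommGroup E'] [NormedSpace ℝ E']
    {H' : Type*} [TopologicalSpace H'] {J : ModelWithCorners ℝ E' H'}
    {N : Type*} [TopologicalSpace N] [ChartedSpace H' N] [IsManifold J ∞ N] {f : Q → N}
    (hf : ContMDiff I J ∞ f) :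
    ContMDiff (velModel k I) (velModel k J) ∞ (T1kMap (k := k) I J f) := by
  intro v₀
  have hid : ContMDiffAt (velModel k I) (velModel k I) ∞ (fun v : T1k k I Q => v) v₀ :=
    contMDiffAt_id
  obtain ⟨h1, h2⟩ := contMDiffAt_totalSpace.1 hid
  refine contMDiffAt_totalSpace.2 ⟨(hf v₀.proj).comp v₀ h1, ?_⟩
  have h3 := ((hf v₀.proj).mfderiv_const (m := ∞) (by simp)).comp v₀ h1
  refine (h3.clm_comp h2).congr_of_eventuallyEq ?_
  have hs1 := h1.continuousAt.preimage_mem_nhds ((chartAt H v₀.proj).open_source.mem_nhds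
    (mem_chart_source H v₀.proj))
  have hs2 := ((hf v₀.proj).comp v₀ h1).continuousAt.preimage_mem_nhds
    ((chartAt H' (f v₀.proj)).open_source.mem_nhds (mem_chart_source H' (f v₀.proj)))
  filter_upwards [hs1, hs2] with v hv hv'
  have hinv := mfderivWithin_extChartAt_symm_comp_mfderiv_extChartAt' (I := I)
    (x := v₀.proj) (y := v.proj) (by simpa using hv)
  refine (T1k.trivializationAt_snd (k := k) (I := J) (v := T1kMap (k := k) I J f v) hv').trans ?_
  have e1 := T1k.trivializationAt_snd (k := k) (I := I) hv
  let a : E' →L[ℝ] E' := mfderiv J 𝓘(ℝ, E') (extChartAt J (f v₀.proj)) (f v.proj)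
  let b : E →L[ℝ] E' := mfderiv I J f v.proj
  let c : E →L[ℝ] E := mfderivWithin 𝓘(ℝ, E) I (extChartAt I v₀.proj).symm (range I)
    (extChartAt I v₀.proj v.proj)
  let d : E →L[ℝ] E := mfderiv I 𝓘(ℝ, E) (extChartAt I v₀.proj) v.proj
  let u : (Fin k → ℝ) →L[ℝ] E := v.2
  have e2 : inTangentCoordinates I J id f (mfderiv I J f) v₀.proj v.proj = (a.comp b).comp c := by
    refine (congrArg₂ (fun (s : E' →L[ℝ] E') (t : E →L[ℝ] E) => s.comp (b.comp t))
      (TangentBundle.continuousLinearMapAt_trivializationAt hv')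
      (TangentBundle.symmL_trivializationAt hv))
  have hcd : c.comp d = ContinuousLinearMap.id ℝ E := hinv
  have e3 : a.comp (b.comp u) = ((a.comp b).comp c).comp (d.comp u) := by
    rw [ContinuousLinearMap.comp_assoc _ c, ← ContinuousLinearMap.comp_assoc c, hcd]
    rfl
  exact e3.trans (congrArg₂ (fun (s : E →L[ℝ] E') (t : (Fin k → ℝ) →L[ℝ] E) => s.comp t)
    e2.symm e1.symm)

end CanonicalForms

end KSymplectic

end

noncomputable section

namespace KSymplectic

/-! ### Vertical vectors and the Legendre map -/

section Legendre

variable {k : ℕ}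
  {E : Type*} [NormedAddCommGroup E] [NormedSpace ℝ E]
  {H : Type*} [TopologicalSpace H] {I : ModelWithCorners ℝ E H}
  {Q : Type*} [TopologicalSpace Q] [ChartedSpace H Q] [IsManifold I ∞ Q]
  {L : T1k k I Q → ℝ}

theorem mfderiv_tauStar_apply (α : T1kStar k I Q) (w : TangentSpace (covelModel k I) α) :
    mfderiv (covelModel k I) I (tauStar (k := k) I (Q := Q)) α w =
      (w : E × (E →L[ℝ] (Fin k → ℝ))).1 :=
  Bundle.mfderiv_proj_apply α w

/-- The Legendre map covers the identity of `Q`. -/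
theorem mfderiv_legendre_fst
    (hFL : ContMDiff (velModel k I) (covelModel k I) ∞ (legendre I L)) (v : T1k k I Q)
    (w : TangentSpace (velModel k I) v) :
    (mfderiv (velModel k I) (covelModel k I) (legendre I L) v w :
      E × (E →L[ℝ] (Fin k → ℝ))).1 = (w : E × ((Fin k → ℝ) →L[ℝ] E)).1 := by
  have h1 := mfderiv_comp v
    (Bundle.mdifferentiableAt_proj _ : MDifferentiableAt (covelModel k I) I
      (tauStar (k := k) I (Q := Q)) (legendre I L v)) (hFL.mdifferentiable (by simp) v)
  have h2 := congrArg (fun T => T w) h1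
  exact ((mfderiv_tauStar_apply _ _).symm.trans h2.symm).trans (Bundle.mfderiv_proj_apply v w)

theorem mfderiv_energy_of_mfderiv_legendre_eq_zero (hL : ContMDiff (velModel k I) 𝓘(ℝ, ℝ) ∞ L)
    (hFL : ContMDiff (velModel k I) (covelModel k I) ∞ (legendre I L)) (v : T1k k I Q)
    (w : TangentSpace (velModel k I) v)
    (hw : mfderiv (velModel k I) (covelModel k I) (legendre I L) v w = 0) :
    mfderiv (velModel k I) 𝓘(ℝ, ℝ) (energy I L) v w = 0 := by
  have hw1 : (w : E × ((Fin k → ℝ) →L[ℝ] E)).1 = 0 := by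
    rw [← mfderiv_legendre_fst hFL v w, hw]
    rfl
  rw [mfderiv_energy_of_vertical hL hFL v w hw1, hw]
  exact Finset.sum_eq_zero fun A _ => rfl

end Legendre

/-! ### Almost-regular Lagrangians -/

section AlmostRegular

variable {k : ℕ}
  {E : Type*} [NormedAddCommGroup E] [NormedSpace ℝ E]
  {H : Type*} [TopologicalSpace H] {I : ModelWithCorners ℝ E H}
  {Q : Type*} [TopologicalSpace Q] [ChartedSpace H Q] [IsManifold I ∞ Q]
  {EP : Type*} [NormedAddCommGroup EP] [NormedSpace ℝ EP]
  {HP : Type*} [TopologicalSpace HP] {IP : ModelWithCorners ℝ EP HP}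
  {P : Type*} [TopologicalSpace P] [ChartedSpace HP P]
  {L : T1k k I Q → ℝ} {j₀ : P → T1kStar k I Q} {FL₀ : T1k k I Q → P}

namespace IsAlmostRegular

theorem legendre_eq (h : IsAlmostRegular I IP L j₀ FL₀) : legendre I L = j₀ ∘ FL₀ :=
  funext fun v => (h.factor v).symm

theorem contMDiff_legendre (h : IsAlmostRegular I IP L j₀ FL₀) :
    ContMDiff (velModel k I) (covelModel k I) ∞ (legendre I L) := by
  rw [h.legendre_eq]
  exact h.embedding.contMDiff.comp h.submersion.contMDiff

theorem surjective (h : IsAlmostRegular I IP L j₀ FL₀) : Function.Surjective FL₀ := by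
  intro y
  have hy : j₀ y ∈ range (legendre I L) := h.range_eq ▸ mem_range_self y
  obtain ⟨v, hv⟩ := hy
  exact ⟨v, h.embedding.isEmbedding.injective ((h.factor v).trans hv)⟩

theorem preimage_eq (h : IsAlmostRegular I IP L j₀ FL₀) (v : T1k k I Q) :
    FL₀ ⁻¹' {FL₀ v} = legendre I L ⁻¹' {legendre I L v} := by
  ext v'
  simp only [mem_preimage, mem_singleton_iff, ← h.factor]
  exact h.embedding.isEmbedding.injective.eq_iff.symm

theorem mfderiv_legendre (h : IsAlmostRegular I IP L j₀ FL₀) (v : T1k k I Q)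
    (w : TangentSpace (velModel k I) v) :
    mfderiv (velModel k I) (covelModel k I) (legendre I L) v w =
      mfderiv IP (covelModel k I) j₀ (FL₀ v) (mfderiv (velModel k I) IP FL₀ v w) := by
  rw [h.legendre_eq]
  exact congrArg (fun T => T w) (mfderiv_comp v
    (h.embedding.contMDiff.mdifferentiable (by simp) (FL₀ v))
    (h.submersion.contMDiff.mdifferentiable (by simp) v))

/-- The energy is basic for `FL₀`, hence it descends to `𝒫`. -/
theorem exists_hamiltonian [I.Boundaryless] (h : IsAlmostRegular I IP L j₀ FL₀) :
    ∃ H₀ : P → ℝ, ContMDiff IP 𝓘(ℝ, ℝ) ∞ H₀ ∧ ∀ v, H₀ (FL₀ v) = energy I L v := by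
  refine h.submersion.exists_contMDiff_factor (by simp) h.surjective (fun v => ?_)
    (contMDiff_energy h.smooth h.contMDiff_legendre) fun v w hw => ?_
  · rw [h.preimage_eq]
    exact (h.connected_fibre v).isPreconnected
  · refine mfderiv_energy_of_mfderiv_legendre_eq_zero h.smooth h.contMDiff_legendre v w ?_
    exact (h.mfderiv_legendre v w).trans ((congrArg _ hw).trans
      (ContinuousLinearMap.map_zero (mfderiv IP (covelModel k I) j₀ (FL₀ v))))

/-- Since `FL₀` is a submersion, the field equation for `T¹ₖ(j₀) ∘ X₀ ∘ FL₀` at `v` is the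
Hamiltonian equation for `X₀` at `FL₀(v)`, pulled back by `FL₀`. -/
theorem fieldEquationOn_singleton_iff [I.Boundaryless] [IsManifold IP ∞ P]
    (h : IsAlmostRegular I IP L j₀ FL₀) {H₀ : P → ℝ}
    (hH : ContMDiff IP 𝓘(ℝ, ℝ) ∞ H₀) (hHE : ∀ v, H₀ (FL₀ v) = energy I L v)
    (X₀ : KVectorField k IP P) (v : T1k k I Q) :
    FieldEquationOn I L (inducedAlong I IP j₀ FL₀ X₀) {v} ↔
      SolvesHamiltonAt IP (fun A => pullbackTwoForm IP (covelModel k I) j₀ (canonicalForm I A))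
        H₀ X₀ (FL₀ v) := by
  have hE : energy I L = H₀ ∘ FL₀ := funext fun v => (hHE v).symm
  have hdE : ∀ w, mfderiv (velModel k I) 𝓘(ℝ, ℝ) (energy I L) v w =
      mfderiv IP 𝓘(ℝ, ℝ) H₀ (FL₀ v) (mfderiv (velModel k I) IP FL₀ v w) := by
    intro w
    rw [hE]
    exact congrArg (fun T => T w) (mfderiv_comp v (hH.mdifferentiable (by simp) (FL₀ v))
      (h.submersion.contMDiff.mdifferentiable (by simp) v))
  have hd := h.mfderiv_legendre v
  have hsurj := (h.submersion.isSubmersionAt v).mfderiv_surjective (by simp)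
  rw [FieldEquationOn]
  simp only [mem_singleton_iff, forall_eq, hdE, hd]
  rw [← h.factor v]
  constructor
  · rintro ⟨κ, hκ, heq⟩ y
    obtain ⟨w, rfl⟩ := hsurj y
    obtain rfl : _ = κ := eq_of_heq (TotalSpace.mk.inj hκ).2
    exact heq w
  · intro heq
    exact ⟨_, rfl, fun w => heq _⟩

end IsAlmostRegular

end AlmostRegular

/-! ### Hyper-regular Lagrangians -/

section HyperRegular

variable {k : ℕ}
  {E : Type*} [NormedAddCommGroup E] [NormedSpace ℝ E]
  {H : Type*} [TopologicalSpace H] {I : ModelWithCorners ℝ E H}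
  {Q : Type*} [TopologicalSpace Q] [ChartedSpace H Q] [IsManifold I ∞ Q]
  {L : T1k k I Q → ℝ} {G : T1kStar k I Q → T1k k I Q}

namespace IsHyperRegular

theorem mfderiv_legendre_surjective (h : IsHyperRegular I L G) (v : T1k k I Q) :
    Function.Surjective (mfderiv (velModel k I) (covelModel k I) (legendre I L) v) := by
  intro w
  refine ⟨mfderiv (covelModel k I) (velModel k I) G (legendre I L v) w, ?_⟩
  have hcomp := mfderiv_comp (legendre I L v)
    (h.smooth_legendre.mdifferentiable (by simp) (G (legendre I L v)))
    (h.smooth_inverse.mdifferentiable (by simp) (legendre I L v))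
  rw [show legendre I L ∘ G = id from funext h.right_inv, mfderiv_id, h.left_inv v] at hcomp
  exact (congrArg (fun T => T w) hcomp).symm

theorem mfderiv_energy (h : IsHyperRegular I L G) (v : T1k k I Q)
    (w : TangentSpace (velModel k I) v) :
    mfderiv (velModel k I) 𝓘(ℝ, ℝ) (energy I L) v w =
      mfderiv (covelModel k I) 𝓘(ℝ, ℝ) (energy I L ∘ G) (legendre I L v)
        (mfderiv (velModel k I) (covelModel k I) (legendre I L) v w) := by
  have hH : ContMDiff (covelModel k I) 𝓘(ℝ, ℝ) ∞ (energy I L ∘ G) :=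
    (contMDiff_energy h.smooth h.smooth_legendre).comp h.smooth_inverse
  have hE : (energy I L ∘ G) ∘ legendre I L = energy I L :=
    funext fun v => congrArg (energy I L) (h.left_inv v)
  have hcomp := mfderiv_comp v (hH.mdifferentiable (by simp) (legendre I L v))
    (h.smooth_legendre.mdifferentiable (by simp) v)
  rw [hE] at hcomp
  exact congrArg (fun T => T w) hcomp

theorem solvesHamiltonAt_of_fieldEquationOn (h : IsHyperRegular I L G)
    {K : T1k k I Q → T1k k (covelModel k I) (T1kStar k I Q)}
    {X : KVectorField k (covelModel k I) (T1kStar k I Q)} (hK : FieldEquationOn I L K univ)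
    (hX : ∀ v, X.toMap (covelModel k I) (legendre I L v) = K v) (α : T1kStar k I Q) :
    SolvesHamiltonAt (covelModel k I) (canonicalForm I) (energy I L ∘ G) X α := by
  rw [← h.right_inv α]
  set v := G α
  obtain ⟨κ, hκ, heq⟩ := hK v (mem_univ v)
  obtain rfl : X (legendre I L v) = κ := eq_of_heq (TotalSpace.mk.inj ((hX v).trans hκ)).2
  intro y
  obtain ⟨w, rfl⟩ := h.mfderiv_legendre_surjective v y
  exact (heq w).trans (h.mfderiv_energy v w)

/-- Testing the Hamiltonian equation on vertical vectors determines the base components of `X`: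
they are `∂H/∂p`, which is `v` at `FL(v)`. -/
theorem secondOrderOn (h : IsHyperRegular I L G)
    {X : KVectorField k (covelModel k I) (T1kStar k I Q)}
    (hX : ∀ α, SolvesHamiltonAt (covelModel k I) (canonicalForm I) (energy I L ∘ G) X α) :
    SecondOrderOn I (fun v => X.toMap (covelModel k I) (legendre I L v)) univ := by
  intro v _
  let u : (Fin k → ℝ) →L[ℝ] E := v.2
  let ξ : (Fin k → ℝ) →L[ℝ] E × (E →L[ℝ] (Fin k → ℝ)) := X (legendre I L v)
  let ξ₁ : (Fin k → ℝ) →L[ℝ] E := (ContinuousLinearMap.fst ℝ E (E →L[ℝ] (Fin k → ℝ))).comp ξ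
  have hpair : ∀ p, pairing p ξ₁ = pairing p u := by
    intro p
    -- `y` is the vertical lift of `p`
    let y : TangentSpace (covelModel k I) (legendre I L v) := ((0, p) : E × (E →L[ℝ] (Fin k → ℝ)))
    obtain ⟨w, hw⟩ := h.mfderiv_legendre_surjective v y
    have hw1 : (w : E × ((Fin k → ℝ) →L[ℝ] E)).1 = 0 := by
      rw [← mfderiv_legendre_fst h.smooth_legendre v w, hw]
    have h1 := mfderiv_energy_of_vertical h.smooth h.smooth_legendre v w hw1
    rw [h.mfderiv_energy, hw] at h1
    have h2 := hX (legendre I L v) y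
    refine Eq.trans ?_ (h2.trans h1)
    refine Finset.sum_congr rfl fun A _ => ?_
    rw [canonicalForm_apply]
    change _ = p (ξ₁ (Pi.single A 1)) A - (ξ (Pi.single A 1)).2 0 A
    rw [map_zero, Pi.zero_apply, sub_zero]
  have hξ : ξ₁ = u := by
    refine sub_eq_zero.1 (eq_zero_of_pairing_eq_zero fun p => ?_)
    have : pairing p (ξ₁ - u) = pairing p ξ₁ - pairing p u := by
      simp [pairing, Finset.sum_sub_distrib]
    rw [this, hpair, sub_self]
  refine congrArg (TotalSpace.mk v.proj) (?_ : _ = u)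
  rw [← hξ]
  refine ContinuousLinearMap.ext fun x => ?_
  exact mfderiv_tauStar_apply (legendre I L v) (X (legendre I L v) x)

set_option synthInstance.maxHeartbeats 200000 in
theorem isFieldOperator (h : IsHyperRegular I L G)
    {X : KVectorField k (covelModel k I) (T1kStar k I Q)}
    (hX : ∀ α, SolvesHamiltonAt (covelModel k I) (canonicalForm I) (energy I L ∘ G) X α) :
    IsFieldOperator I L (fun v => X.toMap (covelModel k I) (legendre I L v)) where
  smooth := X.contMDiff.comp h.smooth_legendre
  structural _ _ := rfl
  fieldEquation v _ :=
    ⟨X (legendre I L v), rfl, fun w => (hX _ _).trans (h.mfderiv_energy v w).symm⟩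
  secondOrder := h.secondOrderOn hX

end IsHyperRegular

end HyperRegular

/-! ### The zero Lagrangian -/

section ZeroLagrangian

variable {k : ℕ}
  {E : Type*} [NormedAddCommGroup E] [NormedSpace ℝ E]
  {H : Type*} [TopologicalSpace H] {I : ModelWithCorners ℝ E H}
  {Q : Type*} [TopologicalSpace Q] [ChartedSpace H Q]

theorem legendre_zero (v : T1k k I Q) :
    legendre I (fun _ : T1k k I Q => (0 : ℝ)) v = ⟨v.proj, 0⟩ := by
  refine congrArg (TotalSpace.mk v.proj) ?_
  have : fderiv ℝ (fun _ : (Fin k → ℝ) →L[ℝ] E => (0 : ℝ)) v.2 = 0 := fderiv_const_apply 0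
  change partials (fderiv ℝ (fun _ : (Fin k → ℝ) →L[ℝ] E => (0 : ℝ)) v.2) = 0
  rw [this]
  rfl

theorem energy_zero (v : T1k k I Q) : energy I (fun _ : T1k k I Q => (0 : ℝ)) v = 0 := by
  simp [energy]

variable [IsManifold I ∞ Q]

/-- The Legendre map of `L = 0` is the projection to `Q` followed by the zero section. -/
theorem isAlmostRegular_zero :
    IsAlmostRegular I I (fun _ : T1k k I Q => (0 : ℝ))
      (zeroSection (E →L[ℝ] (Fin k → ℝ))
        (fun x : Q => TangentSpace I x →L[ℝ] Bundle.Trivial Q (Fin k → ℝ) x))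
      (TotalSpace.proj : T1k k I Q → Q) where
  smooth := contMDiff_const
  embedding := ⟨Bundle.isImmersion_zeroSection,
    Function.LeftInverse.isEmbedding (f := TotalSpace.proj) (fun _ => rfl)
      (FiberBundle.continuous_proj _ _) (Trivialization.continuous_zeroSection ℝ)⟩
  range_eq := by
    ext α
    constructor
    · rintro ⟨q, rfl⟩
      exact ⟨⟨q, 0⟩, legendre_zero _⟩
    · rintro ⟨v, rfl⟩
      exact ⟨v.proj, (legendre_zero v).symm⟩
  closed := Bundle.isClosed_range_zeroSection
  factor v := (legendre_zero v).symm
  submersion := Bundle.isSubmersion_proj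
  connected_fibre v := by
    have hfib : legendre I (fun _ : T1k k I Q => (0 : ℝ)) ⁻¹' {legendre I (fun _ => 0) v} =
        (fun u : (Fin k → ℝ) →L[ℝ] E => (⟨v.proj, u⟩ : T1k k I Q)) '' univ := by
      ext v'
      simp only [mem_preimage, mem_singleton_iff, legendre_zero, image_univ, mem_range]
      constructor
      · intro hv'
        have : v.proj = v'.proj := (TotalSpace.mk.inj hv').1.symm
        obtain ⟨q', u'⟩ := v'
        subst this
        exact ⟨u', rfl⟩
      · rintro ⟨u, rfl⟩
        rfl
    rw [hfib]
    exact ((convex_univ.isPathConnected univ_nonempty).isConnected).image _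
      (contMDiff_fibre_T1k v.proj).continuous.continuousOn

theorem solvesHamiltonAt_zero {EP : Type*} [NormedAddCommGroup EP] [NormedSpace ℝ EP]
    {HP : Type*} [TopologicalSpace HP] {IP : ModelWithCorners ℝ EP HP}
    {P : Type*} [TopologicalSpace P] [ChartedSpace HP P] [IsManifold IP ∞ P]
    (j₀ : P → T1kStar k I Q) (y : P) :
    SolvesHamiltonAt IP (fun A => pullbackTwoForm IP (covelModel k I) j₀ (canonicalForm I A))
      (fun _ => (0 : ℝ)) (0 : KVectorField k IP P) y := by
  intro w
  rw [mfderiv_const]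
  refine Finset.sum_eq_zero fun A _ => ?_
  have h0 : mfderiv IP (covelModel k I) j₀ y (component IP ((0 : KVectorField k IP P) y) A) = 0 :=
    ContinuousLinearMap.map_zero _
  change canonicalForm I A (j₀ y) (mfderiv IP (covelModel k I) j₀ y _) _ = 0
  rw [h0, canonicalForm_apply]
  exact sub_eq_zero.2 (congrFun (ContinuousLinearMap.map_zero _) A)

/-- A field operator has base components `v`, while those induced by the zero `k`-vector field
vanish. -/
theorem not_secondOrderOn_zero (hk : 0 < k) [Nontrivial E] [Nonempty Q]
    (j₀ : Q → T1kStar k I Q) :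
    ¬ SecondOrderOn I (inducedAlong I I j₀ (TotalSpace.proj : T1k k I Q → Q)
      (0 : KVectorField k I Q)) univ := by
  intro hso
  obtain ⟨q⟩ := ‹Nonempty Q›
  obtain ⟨e, he⟩ := exists_ne (0 : E)
  let A : Fin k := ⟨0, hk⟩
  let u : (Fin k → ℝ) →L[ℝ] E := ContinuousLinearMap.smulRight (ContinuousLinearMap.proj A) e
  have h1 := congrArg (fun v : T1k k I Q => (v.2 : (Fin k → ℝ) →L[ℝ] E) = 0)
    (hso ⟨q, u⟩ (mem_univ _))
  have h2 : u = 0 := by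
    refine h1.mp (ContinuousLinearMap.ext fun x => ?_)
    have h3 : mfderiv I (covelModel k I) j₀ q ((0 : KVectorField k I Q) q x) = 0 :=
      ContinuousLinearMap.map_zero _
    exact (congrArg (mfderiv (covelModel k I) I (tauStar I) (j₀ q)) h3).trans
      (ContinuousLinearMap.map_zero _)
  refine he ?_
  have h4 : u (Pi.single A 1) = 0 := by rw [h2]; rfl
  simpa [u] using h4

end ZeroLagrangian

end KSymplectic

end

theorem mainTheorem4 (k : ℕ)
    {E : Type*} [NormedAddCommGroup E] [NormedSpace ℝ E] [FiniteDimensional ℝ E]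
    {H : Type*} [TopologicalSpace H] (I : ModelWithCorners ℝ E H) [I.Boundaryless]
    {Q : Type uQ} [TopologicalSpace Q] [ChartedSpace H Q] [IsManifold I ∞ Q]
    [T2Space Q] [ParacompactSpace Q] [ConnectedSpace Q] :
    -- almost-regular Lagrangians
    (∀ {EP : Type*} [NormedAddCommGroup EP] [NormedSpace ℝ EP] [FiniteDimensional ℝ EP]
        {HP : Type*} [TopologicalSpace HP] (IP : ModelWithCorners ℝ EP HP) [IP.Boundaryless]
        {P : Type*} [TopologicalSpace P] [ChartedSpace HP P] [IsManifold IP ∞ P]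
        (L : KSymplectic.T1k k I Q → ℝ) (j₀ : P → KSymplectic.T1kStar k I Q)
        (FL₀ : KSymplectic.T1k k I Q → P),
      KSymplectic.IsAlmostRegular I IP L j₀ FL₀ →
      ∃ H₀ : P → ℝ, ContMDiff IP 𝓘(ℝ, ℝ) ∞ H₀ ∧ (∀ v, H₀ (FL₀ v) = KSymplectic.energy I L v) ∧
        -- direct statement
        (∀ (K : KSymplectic.T1k k I Q →
              KSymplectic.T1k k (KSymplectic.covelModel k I) (KSymplectic.T1kStar k I Q))
            (X₀ : KSymplectic.KVectorField k IP P) (S : Set (KSymplectic.T1k k I Q)),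
          KSymplectic.IsFieldOperator I L K →
          EqOn (KSymplectic.inducedAlong I IP j₀ FL₀ X₀) K S →
          ∀ y ∈ FL₀ '' S,
            KSymplectic.SolvesHamiltonAt IP
              (fun A => KSymplectic.pullbackTwoForm IP (KSymplectic.covelModel k I) j₀
                (KSymplectic.canonicalForm I A)) H₀ X₀ y) ∧
        -- converse
        (∀ (X₀ : KSymplectic.KVectorField k IP P) (S : Set (KSymplectic.T1k k I Q)),
          (∀ y ∈ FL₀ '' S,
            KSymplectic.SolvesHamiltonAt IP
              (fun A => KSymplectic.pullbackTwoForm IP (KSymplectic.covelModel k I) j₀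
                (KSymplectic.canonicalForm I A)) H₀ X₀ y) →
          KSymplectic.SmoothAlong I (KSymplectic.inducedAlong I IP j₀ FL₀ X₀) ∧
          KSymplectic.StructuralOn I L (KSymplectic.inducedAlong I IP j₀ FL₀ X₀) univ ∧
          ∀ K : KSymplectic.T1k k I Q →
              KSymplectic.T1k k (KSymplectic.covelModel k I) (KSymplectic.T1kStar k I Q),
            EqOn (KSymplectic.inducedAlong I IP j₀ FL₀ X₀) K S →
            KSymplectic.StructuralOn I L K S ∧ KSymplectic.FieldEquationOn I L K S)) ∧
    -- in the converse, the second-order condition may fail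
    (0 < k → 0 < Module.finrank ℝ E →
      ∃ (P : Type uQ) (_ : TopologicalSpace P) (_ : ChartedSpace H P) (_ : IsManifold I ∞ P)
        (L : KSymplectic.T1k k I Q → ℝ) (j₀ : P → KSymplectic.T1kStar k I Q)
        (FL₀ : KSymplectic.T1k k I Q → P) (H₀ : P → ℝ) (X₀ : KSymplectic.KVectorField k I P),
        KSymplectic.IsAlmostRegular I I L j₀ FL₀ ∧
        ContMDiff I 𝓘(ℝ, ℝ) ∞ H₀ ∧ (∀ v, H₀ (FL₀ v) = KSymplectic.energy I L v) ∧
        (∀ y, KSymplectic.SolvesHamiltonAt I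
          (fun A => KSymplectic.pullbackTwoForm I (KSymplectic.covelModel k I) j₀
            (KSymplectic.canonicalForm I A)) H₀ X₀ y) ∧
        ¬ KSymplectic.SecondOrderOn I (KSymplectic.inducedAlong I I j₀ FL₀ X₀) univ) ∧
    -- hyper-regular Lagrangians
    (∀ (L : KSymplectic.T1k k I Q → ℝ) (G : KSymplectic.T1kStar k I Q → KSymplectic.T1k k I Q),
      KSymplectic.IsHyperRegular I L G →
      (∀ (K : KSymplectic.T1k k I Q →
            KSymplectic.T1k k (KSymplectic.covelModel k I) (KSymplectic.T1kStar k I Q))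
          (X : KSymplectic.KVectorField k (KSymplectic.covelModel k I)
            (KSymplectic.T1kStar k I Q)),
        KSymplectic.IsFieldOperator I L K →
        (∀ v, X.toMap (KSymplectic.covelModel k I) (KSymplectic.legendre I L v) = K v) →
        ∀ α, KSymplectic.SolvesHamiltonAt (KSymplectic.covelModel k I)
          (KSymplectic.canonicalForm I) (KSymplectic.energy I L ∘ G) X α) ∧
      (∀ X : KSymplectic.KVectorField k (KSymplectic.covelModel k I)
            (KSymplectic.T1kStar k I Q),
        (∀ α, KSymplectic.SolvesHamiltonAt (KSymplectic.covelModel k I)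
          (KSymplectic.canonicalForm I) (KSymplectic.energy I L ∘ G) X α) →
        KSymplectic.IsFieldOperator I L
          (fun v => X.toMap (KSymplectic.covelModel k I) (KSymplectic.legendre I L v)))) := by
  refine ⟨?_, ?_, ?_⟩
  · intro EP _ _ _ HP _ IP _ P _ _ _ L j₀ FL₀ h
    obtain ⟨H₀, hH, hHE⟩ := h.exists_hamiltonian
    have key := h.fieldEquationOn_singleton_iff hH hHE
    refine ⟨H₀, hH, hHE, ?_, ?_⟩
    · rintro K X₀ S hK hEq _ ⟨v, hv, rfl⟩
      refine (key X₀ v).1 ?_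
      rintro _ rfl
      rw [hEq hv]
      exact hK.fieldEquation _ (mem_univ _)
    · intro X₀ S hX
      have hproj : ∀ v, (KSymplectic.inducedAlong I IP j₀ FL₀ X₀ v).proj =
          KSymplectic.legendre I L v := h.factor
      refine ⟨?_, fun v _ => hproj v, fun K hEq => ⟨fun v hv => ?_, fun v hv => ?_⟩⟩
      · exact (KSymplectic.contMDiff_T1kMap h.embedding.contMDiff).comp
          (X₀.contMDiff.comp h.submersion.contMDiff)
      · rw [← hEq hv]
        exact hproj v
      · rw [← hEq hv]
        exact (key X₀ v).2 (hX _ (mem_image_of_mem FL₀ hv)) v rfl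
  -- the zero Lagrangian and the zero `k`-vector field
  · intro hk hdim
    have : Nontrivial E := Module.nontrivial_of_finrank_pos hdim
    exact ⟨Q, inferInstance, inferInstance, inferInstance, fun _ => 0, _, _, fun _ => 0, 0,
      KSymplectic.isAlmostRegular_zero, contMDiff_const,
      fun v => (KSymplectic.energy_zero v).symm, KSymplectic.solvesHamiltonAt_zero _,
      KSymplectic.not_secondOrderOn_zero hk _⟩
  · intro L G h
    exact ⟨fun K X hK hX α => h.solvesHamiltonAt_of_fieldEquationOn hK.fieldEquation hX α,
      fun X hX => h.isFieldOperator hX⟩
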